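/- All graphs are finite, simple and undirected; edge-colourings need not be proper. The rainbow connection number $rc(G)$ of a connected graph $G$ is the least number of colours in an edge-colouring of $G$ such that every two vertices are joined by a path whose edges have pairwise distinct colours. The graph $G$ is 2-edge-connected if it remains connected after the removal of any one edge (and is connected). **Theorem.** Let $G$ be a 2-edge-connected graph of order $n\ge 3$ that is not the 5-cycle $C_5$ (for which $rc(C_5)=3$). Then $$rc(G)\le\begin{cases}2k & \text{if } n=3k+1 \text{ or } n=3k+2,\\ 2k+1 & \text{if } n=3k+3,\end{cases}$$ equivalently $rc(G)\le\lfloor (2n-2)/3\rfloor$; for every $n\ge 3$ this bound is smaller than $4n/5-1$. The bound is tight for every order: for every $k\ge 1$ there are 2-edge-connected graphs of orders $3k+1$ and $3k+2$ with diameter and rainbow connection number both equal to $2k$, and for every $k\ge 0$ there is a 2-edge-connected graph of order $3k+3$ with diameter and rainbow connection number both equal to $2k+1$. -/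

import Mathlib

namespace SimpleGraph

/-- A walk is rainbow for an edge-colouring `c` (not necessarily proper) if the edges it uses have
pairwise distinct colours. It is only used for paths, which never repeat an edge. -/
def IsRainbow {V K : Type*} {G : SimpleGraph V} (c : G.edgeSet → K) {u v : V}
    (p : G.Walk u v) : Prop :=
  Set.InjOn c {e | (e : Sym2 V) ∈ p.edges}

/-- An edge-colouring makes `G` rainbow connected if every two vertices are joined by a rainbow
path. -/
def IsRainbowConnected {V K : Type*} {G : SimpleGraph V} (c : G.edgeSet → K) : Prop :=
  ∀ u v : V, ∃ p : G.Walk u v, p.IsPath ∧ IsRainbow c p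

/-- The rainbow connection number: the least `t` such that some edge-colouring with colours from a
set of `t` colours makes `G` rainbow connected (and `⊤` if there is no such `t`, which for a finite
graph means that it is disconnected). -/
noncomputable def rainbowConnectionNumber {V : Type*} (G : SimpleGraph V) : ℕ∞ :=
  ⨅ (t : ℕ) (_ : ∃ c : G.edgeSet → Fin t, IsRainbowConnected c), (t : ℕ∞)

end SimpleGraph

/-!
The upper bound rests on two observations about colouring a 2-edge-connected graph piece by piece.

*Ears.* Let the subgraph induced by `H` be rainbow connected, and let an ear of `H` have `m` edges.
With `t = ⌊m / 2⌋` new colours, colour the first `t` edges of the ear by `1, …, t` in this order,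
the last `t` edges by `1, …, t` again, and the middle edge, present if `m` is odd, by any old
colour. The union is rainbow connected (`IsEar.colourable`): two vertices on different halves of
the ear are joined either across the middle or around through `H`. So an ear with at least two
inner vertices costs at most two thirds of a colour per vertex, and it saves a third of a colour or
more unless it has exactly three inner vertices.

*Single vertices.* What remains in a 2-connected graph when there are no such ears left are
independent vertices with two neighbours each in `H`. Three or more of them cost two colours
together, and a single one costs one colour. Two of them cost just one colour, provided that some
neighbour of the first and some neighbour of the second are joined by a rainbow path that misses a
colour. A colouring in which this holds for any two pairs of vertices is called ample here; ears
preserve ampleness (`IsEar.ampleOn`).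

Hence, if some `H` has an ample colouring with `k` colours and `3 k + 3 ≤ 2 |H|`, the bound follows
for the whole 2-connected graph (`TwoConnectedOn.economical_of_ampleOn`). Such an `H` is a triangle,
an even cycle of length at least six, or an odd cycle of length at least five with one pendant
vertex, whose edge takes the colour of the middle edge of the cycle
(`IsCycleMap.exists_ampleOn_insert`). A cycle of length four that does not span the graph has an
ear, and with it forms a longer cycle or a triangle, or `K_{2,3}`, which is ample with two colours.
A cycle that spans the graph satisfies the bound by itself, except `C₅`
(`TwoConnectedOn.economical_or_five_cycle`).

At a cut vertex the numbers of colours add up, and so do the bounds. A block `C₅` is an ear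
with coinciding ends and costs only two colours, since its middle edge takes a colour from
elsewhere (`TwoEdgeConnectedOn.economical_or_isFiveCycleOn`).

For the lower bound, the diameter never exceeds the rainbow connection number. The extremal graphs
have levels of sizes `1, 2, 1, 2, …`, except for one odd level of size three if the order is
`3 k + 2`, and vertices are adjacent when their levels differ by at most one: every
edge lies in a triangle, and the diameter is the number of the last level (`levelGraph_spec`).
-/

namespace RainbowConnection

open SimpleGraph

section

variable {V : Type*} {G : SimpleGraph V} {c c' : Sym2 V → ℕ} {H H' S : Finset V}
  {A B C : Set ℕ} {u v w a b : V} {k : ℕ}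

/-! ### Rainbow walks inside a vertex set -/

/-- `u` and `v` are joined by a walk of `G` that stays in `H` and whose edges have pairwise distinct
colours, all taken from the palette `A`. Colourings are defined on all of `Sym2 V`, so that they
need not change type when `H` grows. -/
def Linked (G : SimpleGraph V) (c : Sym2 V → ℕ) (H : Finset V) (A : Set ℕ) (u v : V) : Prop :=
  ∃ p : G.Walk u v, (∀ x ∈ p.support, x ∈ H) ∧ (p.edges.map c).Nodup ∧ ∀ e ∈ p.edges, c e ∈ A

theorem Linked.refl (hu : u ∈ H) : Linked G c H A u u :=
  ⟨.nil, by simpa using hu, by simp, by simp⟩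

theorem Linked.symm (h : Linked G c H A u v) : Linked G c H A v u := by
  obtain ⟨p, h1, h2, h3⟩ := h
  exact ⟨p.reverse, by simpa using h1, by simpa using h2, by simpa using h3⟩

theorem Linked.edge (hu : u ∈ H) (hv : v ∈ H) (h : G.Adj u v) (hc : c s(u, v) ∈ A) :
    Linked G c H A u v :=
  ⟨h.toWalk, by simp [hu, hv], by simp, by simpa using hc⟩

theorem Linked.mono (h : Linked G c H A u v) (hH : H ⊆ H') (hA : A ⊆ B) :
    Linked G c H' B u v := by
  obtain ⟨p, h1, h2, h3⟩ := h
  exact ⟨p, fun x hx => hH (h1 x hx), h2, fun e he => hA (h3 e he)⟩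

theorem Linked.trans (h : Linked G c H A u v) (h' : Linked G c H B v w) (hd : Disjoint A B)
    (hA : A ⊆ C) (hB : B ⊆ C) : Linked G c H C u w := by
  obtain ⟨p, h1, h2, h3⟩ := h
  obtain ⟨q, h1', h2', h3'⟩ := h'
  refine ⟨p.append q, ?_, ?_, ?_⟩
  · intro x hx
    rw [Walk.mem_support_append_iff] at hx
    exact hx.elim (h1 x) (h1' x)
  · rw [Walk.edges_append, List.map_append, List.nodup_append]
    refine ⟨h2, h2', ?_⟩
    intro x hx y hy hxy
    obtain ⟨e, he, rfl⟩ := List.mem_map.1 hx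
    obtain ⟨e', he', rfl⟩ := List.mem_map.1 hy
    exact Set.disjoint_left.1 hd (h3 e he) (hxy ▸ h3' e' he')
  · intro e he
    rw [Walk.edges_append, List.mem_append] at he
    exact he.elim (fun h => hA (h3 e h)) (fun h => hB (h3' e h))

/-- Recolouring along an injection that agrees with the new colouring on the edges inside `H`. -/
theorem Linked.map {φ : ℕ → ℕ} (h : Linked G c H A u v) (hφ : Function.Injective φ)
    (hc : ∀ a ∈ H, ∀ b ∈ H, G.Adj a b → c' s(a, b) = φ (c s(a, b))) :
    Linked G c' H (φ '' A) u v := by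
  obtain ⟨p, h1, h2, h3⟩ := h
  have key : ∀ e ∈ p.edges, c' e = φ (c e) := by
    intro e
    induction e with
    | _ a b =>
      intro he
      exact hc a (h1 a (p.fst_mem_support_of_mem_edges he)) b
        (h1 b (p.snd_mem_support_of_mem_edges he)) (p.adj_of_mem_edges he)
  refine ⟨p, h1, ?_, fun e he => ⟨c e, h3 e he, (key e he).symm⟩⟩
  rw [List.map_congr_left key, ← Function.comp_def, ← List.map_map]
  exact h2.map hφ

theorem Linked.congr (h : Linked G c H A u v)
    (hc : ∀ a ∈ H, ∀ b ∈ H, c' s(a, b) = c s(a, b)) : Linked G c' H A u v := by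
  simpa using h.map (φ := id) (c' := c') Function.injective_id (fun a ha b hb _ => hc a ha b hb)

/-- A path along which the colours increase by one at each step links any two of its vertices. -/
theorem Linked.arc {f : ℕ → V} {t : ℕ} (hH : ∀ i ≤ t, f i ∈ H)
    (hadj : ∀ i < t, G.Adj (f i) (f (i + 1))) (hc : ∀ i < t, c s(f i, f (i + 1)) = k + i)
    {i j : ℕ} (hij : i ≤ j) (hj : j ≤ t) :
    Linked G c H (Set.Ico (k + i) (k + j)) (f i) (f j) := by
  induction j, hij using Nat.le_induction with
  | base => exact .refl (hH i hj)
  | succ j hij ih =>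
    refine (ih (by omega)).trans (B := {k + j})
      (.edge (hH j (by omega)) (hH _ hj) (hadj j (by omega)) (by simp [hc j (by omega)])) ?_ ?_ ?_
    · simp
    · intro x; simp only [Set.mem_Ico]; omega
    · intro x; simp only [Set.mem_Ico, Set.mem_singleton_iff]; omega

/-- With the colours `0, …, k - 1`, the colouring `c` makes the subgraph induced by `H` rainbow
connected. -/
def RainbowOn (G : SimpleGraph V) (c : Sym2 V → ℕ) (H : Finset V) (k : ℕ) : Prop :=
  ∀ u ∈ H, ∀ v ∈ H, Linked G c H (Set.Iio k) u v

/-- The subgraph induced by `H` can be made rainbow connected with `k` colours. -/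
def Colourable (G : SimpleGraph V) (H : Finset V) (k : ℕ) : Prop :=
  ∃ c, RainbowOn G c H k

/-- `a` and `b` are joined by a rainbow walk in `H` that misses one of the `k` colours. -/
def Slack (G : SimpleGraph V) (c : Sym2 V → ℕ) (H : Finset V) (k : ℕ) (a b : V) : Prop :=
  ∃ i < k, Linked G c H (Set.Iio k \ {i}) a b

/-- A rainbow colouring of `H` with `k` colours in which any two pairs of vertices contain two
vertices, one of each pair, that are joined by a rainbow walk missing a colour. This is what
allows two further vertices, with two neighbours each in `H`, to be added at the price of a single
colour. -/
def AmpleOn (G : SimpleGraph V) (c : Sym2 V → ℕ) (H : Finset V) (k : ℕ) : Prop :=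
  RainbowOn G c H k ∧ ∀ u₁ ∈ H, ∀ v₁ ∈ H, ∀ u₂ ∈ H, ∀ v₂ ∈ H, u₁ ≠ v₁ → u₂ ≠ v₂ →
    Slack G c H k u₁ u₂ ∨ Slack G c H k u₁ v₂ ∨ Slack G c H k v₁ u₂ ∨ Slack G c H k v₁ v₂

theorem Slack.symm (h : Slack G c H k a b) : Slack G c H k b a :=
  let ⟨i, hi, h⟩ := h
  ⟨i, hi, h.symm⟩

theorem Slack.of_edge (hk : 2 ≤ k) (hu : u ∈ H) (hv : v ∈ H) (h : G.Adj u v)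
    (hc : c s(u, v) < k) : Slack G c H k u v := by
  by_cases h0 : c s(u, v) = 0
  · exact ⟨1, by omega, .edge hu hv h (by simp [h0]; omega)⟩
  · exact ⟨0, by omega, .edge hu hv h (by simp [h0, hc])⟩

theorem Slack.refl (hk : 0 < k) (hu : u ∈ H) : Slack G c H k u u :=
  ⟨0, hk, .refl hu⟩

theorem RainbowOn.mono {k' : ℕ} (h : RainbowOn G c H k) (hk : k ≤ k') : RainbowOn G c H k' :=
  fun u hu v hv => (h u hu v hv).mono (subset_refl _) (Set.Iio_subset_Iio hk)

theorem rainbowOn_singleton (x : V) : RainbowOn G c {x} k := by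
  intro u hu v hv
  rw [Finset.mem_singleton] at hu hv
  subst hu hv
  exact .refl (by simp)

theorem ampleOn_singleton (x : V) : AmpleOn G c {x} k := by
  refine ⟨rainbowOn_singleton x, ?_⟩
  intro u₁ hu v₁ hv
  rw [Finset.mem_singleton] at hu hv
  simp [hu, hv]

/-! ### Ears -/

/-- An ear of `H` with `m` edges: a walk `f 0, …, f m` with ends in `H` and with its `m - 1` inner
vertices distinct and outside `H`. The ends may coincide. Values of `f` beyond `m` play no role. -/
structure IsEar (G : SimpleGraph V) (H : Finset V) (f : ℕ → V) (m : ℕ) : Prop where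
  start : f 0 ∈ H
  finish : f m ∈ H
  adj : ∀ i < m, G.Adj (f i) (f (i + 1))
  out : ∀ i, 0 < i → i < m → f i ∉ H
  inj : ∀ i j, 0 < i → i < j → j < m → f i ≠ f j

/-- `H` together with the inner vertices of an ear. -/
def addEar [DecidableEq V] (H : Finset V) (f : ℕ → V) (m : ℕ) : Finset V :=
  H ∪ (Finset.Ico 1 m).image f

theorem mem_addEar [DecidableEq V] {f : ℕ → V} {m : ℕ} {x : V} :
    x ∈ addEar H f m ↔ x ∈ H ∨ ∃ i, 0 < i ∧ i < m ∧ f i = x := by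
  simp [addEar, Nat.succ_le_iff, and_assoc]

namespace IsEar

variable {f : ℕ → V} {m : ℕ}

theorem card_addEar [DecidableEq V] (he : IsEar G H f m) :
    (addEar H f m).card = H.card + (m - 1) := by
  rw [addEar, Finset.card_union_of_disjoint, Finset.card_image_of_injOn, Nat.card_Ico]
  · intro i hi j hj hij
    simp only [Finset.coe_Ico, Set.mem_Ico] at hi hj
    rcases lt_trichotomy i j with h | h | h
    · exact absurd hij (he.inj i j (by omega) h (by omega))
    · exact h
    · exact absurd hij.symm (he.inj j i (by omega) h (by omega))
  · rw [Finset.disjoint_left]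
    intro x hx hx'
    obtain ⟨i, hi, rfl⟩ := Finset.mem_image.1 hx'
    rw [Finset.mem_Ico] at hi
    exact he.out i (by omega) (by omega) hx

theorem mem_addEar_of_le [DecidableEq V] (he : IsEar G H f m) {i : ℕ} (hi : i ≤ m) :
    f i ∈ addEar H f m := by
  rw [mem_addEar]
  rcases Nat.eq_zero_or_pos i with rfl | h
  · exact .inl he.start
  · rcases hi.eq_or_lt with rfl | h'
    · exact .inl he.finish
    · exact .inr ⟨i, h, h', rfl⟩

theorem edge_injective (he : IsEar G H f m) (hm : 2 ≤ m) (hm' : m = 2 → f 0 ≠ f 2) {i j : ℕ}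
    (hij : i < j) (hj : j < m) : s(f i, f (i + 1)) ≠ s(f j, f (j + 1)) := by
  -- an inner vertex differs from every other vertex of the ear
  have inner : ∀ a b, 0 < a → a < m → b ≤ m → a ≠ b → f a ≠ f b := by
    intro a b ha ham hb hab h
    rcases Nat.eq_zero_or_pos b with rfl | hb0
    · exact he.out a ha ham (h ▸ he.start)
    · rcases hb.eq_or_lt with rfl | hb'
      · exact he.out a ha ham (h ▸ he.finish)
      · rcases lt_or_gt_of_ne hab with h' | h'
        · exact he.inj a b ha h' hb' h
        · exact he.inj b a hb0 h' ham h.symm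
  intro h
  rcases Sym2.eq_iff.1 h with ⟨h1, h2⟩ | ⟨h1, h2⟩
  · exact inner j i (by omega) hj (by omega) (by omega) h1.symm
  · rcases Nat.eq_zero_or_pos i with rfl | hi
    · rcases Nat.lt_or_ge (j + 1) m with h' | h'
      · exact inner (j + 1) 0 (by omega) h' (by omega) (by omega) h1.symm
      · rcases Nat.lt_or_ge 1 j with h'' | h''
        · exact inner 1 j (by omega) (by omega) (by omega) (by omega) h2
        · obtain rfl : j = 1 := by omega
          exact hm' (by omega) h1
    · exact inner i (j + 1) hi (by omega) (by omega) (by omega) h1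

/-- The colouring of an ear with `t = ⌊m / 2⌋` new colours: `k, …, k + t - 1` along each half, and
the colour `x` on the middle edge if there is one. -/
theorem exists_colouring (he : IsEar G H f m) (hm : 2 ≤ m) (hm' : m = 2 → f 0 ≠ f 2)
    (c : Sym2 V → ℕ) (k x : ℕ) {t : ℕ} (ht : t = m / 2) :
    ∃ c' : Sym2 V → ℕ, (∀ a ∈ H, ∀ b ∈ H, c' s(a, b) = c s(a, b)) ∧
      (∀ i < t, c' s(f i, f (i + 1)) = k + i) ∧
      (∀ i < t, c' s(f (m - t + i), f (m - t + (i + 1))) = k + i) ∧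
      (m = 2 * t + 1 → c' s(f t, f (t + 1)) = x) := by
  let e : Fin m → Sym2 V := fun i => s(f i, f (i + 1))
  let g : Fin m → ℕ := fun i => if i.1 < t then k + i else if m - t ≤ i then k + (i - (m - t)) else x
  have hinj : Function.Injective e := by
    intro i j hij
    by_contra hne
    rcases lt_or_gt_of_ne (fun h => hne (Fin.ext h) : i.1 ≠ j.1) with h | h
    · exact he.edge_injective hm hm' h j.2 hij
    · exact he.edge_injective hm hm' h i.2 hij.symm
  have hval : ∀ i (hi : i < m), Function.extend e g c s(f i, f (i + 1)) = g ⟨i, hi⟩ :=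
    fun i hi => hinj.extend_apply g c ⟨i, hi⟩
  refine ⟨Function.extend e g c, ?_, ?_, ?_, ?_⟩
  · intro a ha b hb
    apply Function.extend_apply'
    rintro ⟨⟨i, hi⟩, h⟩
    have : f i ∈ H ∧ f (i + 1) ∈ H := by
      rcases Sym2.eq_iff.1 h with ⟨h1, h2⟩ | ⟨h1, h2⟩ <;> simp only [h1, h2, ha, hb, and_self]
    rcases Nat.eq_zero_or_pos i with rfl | h0
    · exact he.out 1 (by omega) (by omega) this.2
    · exact he.out i h0 hi this.1
  · intro i hi
    rw [hval i (by omega)]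
    simp [g, hi]
  · intro i hi
    rw [← add_assoc, hval (m - t + i) (by omega)]
    simp only [g]
    rw [if_neg (by omega), if_pos (by omega)]
    omega
  · intro hmt
    rw [hval t (by omega)]
    simp only [g]
    rw [if_neg (by omega), if_neg (by omega)]

end IsEar

/-! ### Cycles -/

/-- `f 0, …, f (m - 1)` are the distinct vertices of a cycle of `G`, and `f m` is `f 0` again. -/
structure IsCycleMap (G : SimpleGraph V) (f : ℕ → V) (m : ℕ) : Prop where
  closed : f m = f 0
  adj : ∀ i < m, G.Adj (f i) (f (i + 1))
  inj : ∀ i j, i < j → j < m → f i ≠ f j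

namespace IsCycleMap

variable {f g r : ℕ → V} {m M L : ℕ}

theorem injOn (h : IsCycleMap G f m) {i j : ℕ} (hi : i < m) (hj : j < m) (hij : f i = f j) :
    i = j := by
  rcases lt_trichotomy i j with h' | h' | h'
  · exact absurd hij (h.inj i j h' hj)
  · exact h'
  · exact absurd hij.symm (h.inj j i h' hi)

theorem isEar (h : IsCycleMap G f m) : IsEar G {f 0} f m where
  start := by simp
  finish := by simp [h.closed]
  adj := h.adj
  out i h0 hi := by
    rw [Finset.mem_singleton]
    exact fun h' => h.inj 0 i h0 hi h'.symm
  inj i j _ hij hj := h.inj i j hij hj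

/-- An ear of `H` and a path in `H` with the same ends form a cycle. -/
theorem of_isEar (he : IsEar G H g M) (hM : 0 < M) (hr0 : r 0 = g M) (hrL : r L = g 0)
    (hrH : ∀ i ≤ L, r i ∈ H) (hradj : ∀ i < L, G.Adj (r i) (r (i + 1)))
    (hrinj : ∀ i j, i < j → j ≤ L → r i ≠ r j) :
    IsCycleMap G (fun i => if i < M then g i else r (i - M)) (M + L) := by
  refine ⟨by simp [hrL, hM], fun i hi => ?_, fun i j hij hj => ?_⟩
  · by_cases h1 : i + 1 < M
    · rw [if_pos (by omega), if_pos h1]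
      exact he.adj i (by omega)
    · by_cases h2 : i < M
      · obtain rfl : M = i + 1 := by omega
        rw [if_pos h2, if_neg h1, Nat.sub_self, hr0]
        exact he.adj i h2
      · rw [if_neg h2, if_neg h1, show i + 1 - M = i - M + 1 by omega]
        exact hradj _ (by omega)
  · by_cases h1 : j < M
    · rw [if_pos (by omega), if_pos h1]
      rcases Nat.eq_zero_or_pos i with rfl | h0
      · exact fun h => he.out j hij h1 (h ▸ he.start)
      · exact he.inj i j h0 hij h1
    · rw [if_neg h1]
      by_cases h2 : i < M
      · rw [if_pos h2]
        rcases Nat.eq_zero_or_pos i with rfl | h0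
        · rw [← hrL]
          exact (hrinj _ _ (by omega) le_rfl).symm
        · exact fun h => he.out i h0 h2 (h ▸ hrH _ (by omega))
      · rw [if_neg h2]
        exact hrinj _ _ (by omega) (by omega)

end IsCycleMap

end

section

variable {V : Type*} [DecidableEq V] {G : SimpleGraph V} {c c' : Sym2 V → ℕ} {H : Finset V}
  {a b y : V} {k x t m : ℕ} {f : ℕ → V}

/-! ### Colouring an ear -/

/-- What the colouring `c'` of `IsEar.exists_colouring` provides: links along the left half
`f 0, …, f t` and the right half `f (m - t), …, f m` of the ear, a link between the two halves in
colour `x`, and all the links of the old colouring `c`. -/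
structure EarColouring (G : SimpleGraph V) (c c' : Sym2 V → ℕ) (H : Finset V) (f : ℕ → V)
    (m t k x : ℕ) : Prop where
  left : ∀ i j, i ≤ j → j ≤ t →
    Linked G c' (addEar H f m) (Set.Ico (k + i) (k + j)) (f i) (f j)
  right : ∀ i j, i ≤ j → j ≤ t →
    Linked G c' (addEar H f m) (Set.Ico (k + i) (k + j)) (f (m - t + i)) (f (m - t + j))
  mid : Linked G c' (addEar H f m) {x} (f t) (f (m - t))
  old : ∀ {A u v}, Linked G c H A u v → Linked G c' (addEar H f m) A u v

theorem IsEar.exists_earColouring (he : IsEar G H f m) (hm : 2 ≤ m) (hm' : m = 2 → f 0 ≠ f 2)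
    (c : Sym2 V → ℕ) (k x : ℕ) (ht : t = m / 2) : ∃ c', EarColouring G c c' H f m t k x := by
  obtain ⟨c', h1, h2, h3, h4⟩ := he.exists_colouring hm hm' c k x ht
  refine ⟨c', ⟨fun i j hij hj => ?_, fun i j hij hj => ?_, ?_, fun h => ?_⟩⟩
  · exact Linked.arc (fun i hi => he.mem_addEar_of_le (by omega)) (fun i hi => he.adj i (by omega))
      h2 hij hj
  · exact Linked.arc (f := fun i => f (m - t + i)) (fun i hi => he.mem_addEar_of_le (by omega))
      (fun i hi => he.adj (m - t + i) (by omega)) h3 hij hj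
  · by_cases hmt : m = 2 * t + 1
    · have : m - t = t + 1 := by omega
      rw [this]
      exact .edge (he.mem_addEar_of_le (by omega)) (he.mem_addEar_of_le (by omega))
        (he.adj t (by omega)) (h4 hmt)
    · have : m - t = t := by omega
      rw [this]
      exact .refl (he.mem_addEar_of_le (by omega))
  · exact (h.congr h1).mono Finset.subset_union_left (subset_refl _)

/-- Every vertex lies in the old part, on the left half or on the right half. -/
theorem mem_addEar_cases (ht : t = m / 2) {z : V} (hz : z ∈ addEar H f m) :
    z ∈ H ∨ (∃ i, 0 < i ∧ i ≤ t ∧ z = f i) ∨ ∃ j < t, z = f (m - t + j) := by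
  rcases mem_addEar.1 hz with h | ⟨i, h0, hi, rfl⟩
  · exact .inl h
  · by_cases hit : i ≤ t
    · exact .inr (.inl ⟨i, h0, hit, rfl⟩)
    · exact .inr (.inr ⟨i - (m - t), by omega, by congr 1; omega⟩)

namespace EarColouring

variable (hc : EarColouring G c c' H f m t k x) (he : IsEar G H f m) (ht : t = m / 2)
  (hH : RainbowOn G c H k)

include hc

/-- The link from the old part to the left half, given a link to the left end of the ear. -/
theorem old_left {A : Set ℕ} (hA : A ⊆ Set.Iio k) {i : ℕ} (hi : i ≤ t)
    (hy : Linked G c H A y (f 0)) :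
    Linked G c' (addEar H f m) (A ∪ Set.Ico k (k + i)) y (f i) := by
  refine (hc.old hy).trans (hc.left 0 i (by omega) hi) ?_ ?_ ?_
  · rw [Set.disjoint_left]
    intro z hz
    have := hA hz
    simp only [Set.mem_Iio, Set.mem_Ico] at this ⊢
    omega
  · exact Set.subset_union_left
  · simp

/-- The link from the old part to the right half, given a link to the right end of the ear. -/
theorem old_right (ht' : t ≤ m) {A : Set ℕ} (hA : A ⊆ Set.Iio k) {j : ℕ} (hj : j ≤ t)
    (hy : Linked G c H A y (f m)) :
    Linked G c' (addEar H f m) (A ∪ Set.Ico (k + j) (k + t)) y (f (m - t + j)) := by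
  have h := hc.right j t hj le_rfl
  rw [Nat.sub_add_cancel ht'] at h
  refine (hc.old hy).trans h.symm ?_ ?_ ?_
  · rw [Set.disjoint_left]
    intro z hz
    have := hA hz
    simp only [Set.mem_Iio, Set.mem_Ico] at this ⊢
    omega
  · exact Set.subset_union_left
  · exact Set.subset_union_right

/-- Crossing the middle of the ear. -/
theorem left_right_inner (hx : x < k) {i j : ℕ} (hji : j ≤ i) (hi : i ≤ t) :
    Linked G c' (addEar H f m) ({x} ∪ Set.Ico (k + i) (k + t) ∪ Set.Ico k (k + j)) (f i)
      (f (m - t + j)) := by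
  refine ((hc.left i t hi le_rfl).trans (C := {x} ∪ Set.Ico (k + i) (k + t)) hc.mid
    ?_ Set.subset_union_right Set.subset_union_left).trans
    (hc.right 0 j (by omega) (by omega)) ?_ ?_ ?_
  · simp only [Set.disjoint_singleton_right, Set.mem_Ico]; omega
  · rw [Set.disjoint_left]
    simp only [Set.mem_union, Set.mem_singleton_iff, Set.mem_Ico]
    omega
  · exact Set.subset_union_left
  · simp

/-- Going around through the old part. -/
theorem left_right_outer (ht' : t ≤ m) {A : Set ℕ} (hA : A ⊆ Set.Iio k)
    (hfm : Linked G c H A (f 0) (f m)) {i j : ℕ} (hij : i ≤ j) (hj : j ≤ t) :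
    Linked G c' (addEar H f m) (Set.Ico k (k + i) ∪ A ∪ Set.Ico (k + j) (k + t)) (f i)
      (f (m - t + j)) := by
  have h0 := hc.left 0 i (by omega) (by omega)
  refine h0.symm.trans (hc.old_right ht' hA hj hfm) ?_ ?_ ?_
  · rw [Set.disjoint_left]
    intro z hz hz'
    simp only [add_zero, Set.mem_Ico] at hz
    rcases hz' with h | h
    · have := hA h
      simp only [Set.mem_Iio] at this
      omega
    · simp only [Set.mem_Ico] at h
      omega
  · intro z; simp only [add_zero, Set.mem_union]; tauto
  · intro z; simp only [Set.mem_union]; tauto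

include he ht hH

/-- Any two vertices of the enlarged set are linked, and there is slack between them except
possibly in two situations: between an old vertex and one of the innermost vertices `f t` and
`f (m - t)`, in case the old colouring gives no slack to the corresponding end of the ear, and
between `f i` and `f (m - t + i)`. -/
theorem linked_or_slack (ht1 : 1 ≤ t) (hx : x < k ∨ m = 2 * t) (ha : a ∈ addEar H f m)
    (hb : b ∈ addEar H f m) :
    Linked G c' (addEar H f m) (Set.Iio (k + t)) a b ∧
    (Slack G c' (addEar H f m) (k + t) a b ∨
      (a ∈ H ∧ (b = f t ∧ ¬ Slack G c H k a (f 0) ∨ b = f (m - t) ∧ ¬ Slack G c H k a (f m))) ∨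
      (b ∈ H ∧ (a = f t ∧ ¬ Slack G c H k b (f 0) ∨ a = f (m - t) ∧ ¬ Slack G c H k b (f m))) ∨
      ∃ i, 0 < i ∧ i < t ∧ (a = f i ∧ b = f (m - t + i) ∨ b = f i ∧ a = f (m - t + i))) := by
  have slack : ∀ {A u v}, ∀ i < k + t, Linked G c' (addEar H f m) A u v → A ⊆ Set.Iio (k + t) →
      i ∉ A → Linked G c' (addEar H f m) (Set.Iio (k + t)) u v ∧
        Slack G c' (addEar H f m) (k + t) u v := by
    intro A u v i hi h hA hiA
    refine ⟨h.mono (subset_refl _) hA, i, hi, h.mono (subset_refl _) fun z hz => ⟨hA hz, ?_⟩⟩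
    rintro rfl
    exact hiA hz
  -- the three kinds of pairs that need an argument, in one orientation
  have hl : ∀ y ∈ H, ∀ i, i ≤ t → Linked G c' (addEar H f m) (Set.Iio (k + t)) y (f i) ∧
      (Slack G c' (addEar H f m) (k + t) y (f i) ∨ f i = f t ∧ ¬ Slack G c H k y (f 0)) := by
    intro y hy i hi
    by_cases hit : i < t
    · have := slack (k + i) (by omega) (hc.old_left (subset_refl _) hi (hH y hy _ he.start))
        (by intro z; simp only [Set.mem_union, Set.mem_Iio, Set.mem_Ico]; omega)
        (by simp only [Set.mem_union, Set.mem_Iio, Set.mem_Ico]; omega)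
      exact ⟨this.1, .inl this.2⟩
    · obtain rfl : i = t := by omega
      refine ⟨(hc.old_left (subset_refl _) hi (hH y hy _ he.start)).mono (subset_refl _)
        (by intro z; simp only [Set.mem_union, Set.mem_Iio, Set.mem_Ico]; omega), ?_⟩
      by_cases hs : Slack G c H k y (f 0)
      · obtain ⟨j, hj, h⟩ := hs
        exact .inl (slack j (by omega) (hc.old_left Set.sdiff_subset hi h)
          (by intro z; simp only [Set.mem_union, Set.mem_sdiff, Set.mem_Iio, Set.mem_Ico]; omega)
          (by simp; omega)).2
      · exact .inr ⟨rfl, hs⟩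
  have hr : ∀ y ∈ H, ∀ j, j < t →
      Linked G c' (addEar H f m) (Set.Iio (k + t)) y (f (m - t + j)) ∧
      (Slack G c' (addEar H f m) (k + t) y (f (m - t + j)) ∨
        f (m - t + j) = f (m - t) ∧ ¬ Slack G c H k y (f m)) := by
    intro y hy j hj
    by_cases hj0 : 0 < j
    · have := slack k (by omega) (hc.old_right (by omega) (subset_refl _) hj.le
        (hH y hy _ he.finish))
        (by intro z; simp only [Set.mem_union, Set.mem_Iio, Set.mem_Ico]; omega)
        (by simp only [Set.mem_union, Set.mem_Iio, Set.mem_Ico]; omega)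
      exact ⟨this.1, .inl this.2⟩
    · obtain rfl : j = 0 := by omega
      refine ⟨(hc.old_right (by omega) (subset_refl _) hj.le (hH y hy _ he.finish)).mono
        (subset_refl _) (by intro z; simp only [Set.mem_union, Set.mem_Iio, Set.mem_Ico]; omega), ?_⟩
      by_cases hs : Slack G c H k y (f m)
      · obtain ⟨j, hj', h⟩ := hs
        exact .inl (slack j (by omega) (hc.old_right (by omega) Set.sdiff_subset hj.le h)
          (by intro z; simp only [Set.mem_union, Set.mem_sdiff, Set.mem_Iio, Set.mem_Ico]; omega)
          (by simp; omega)).2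
      · exact .inr ⟨rfl, hs⟩
  have hlr : ∀ i j, 0 < i → i ≤ t → j < t →
      Linked G c' (addEar H f m) (Set.Iio (k + t)) (f i) (f (m - t + j)) ∧
      (Slack G c' (addEar H f m) (k + t) (f i) (f (m - t + j)) ∨ i = j) := by
    intro i j hi hit hjt
    rcases lt_or_ge j i with hji | hij
    · have hx' : Linked G c' (addEar H f m) (Set.Iio (k + t) \ {k + j}) (f i) (f (m - t + j)) := by
        by_cases hxk : x < k
        · exact (hc.left_right_inner hxk hji.le hit).mono (subset_refl _)
            (by intro z; simp only [Set.mem_union, Set.mem_sdiff, Set.mem_singleton_iff, Set.mem_Iio,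
                  Set.mem_Ico]; omega)
        · -- there is no middle edge
          have hmt : m - t = t := by omega
          have h1 := hc.right 0 j (by omega) (by omega)
          rw [add_zero, hmt] at h1
          rw [hmt]
          refine (hc.left i t hit le_rfl).trans h1 ?_ ?_ ?_
          · rw [Set.disjoint_left]; intro z; simp only [Set.mem_Ico]; omega
          · intro z; simp only [Set.mem_sdiff, Set.mem_singleton_iff, Set.mem_Iio, Set.mem_Ico]; omega
          · intro z; simp only [Set.mem_sdiff, Set.mem_singleton_iff, Set.mem_Iio, Set.mem_Ico]; omega
      have := slack (k + j) (by omega) hx' Set.sdiff_subset (by simp)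
      exact ⟨this.1, .inl this.2⟩
    · have h := hc.left_right_outer (by omega) (subset_refl _) (hH _ he.start _ he.finish) hij
        (by omega)
      rcases hij.eq_or_lt with h' | h'
      · exact ⟨h.mono (subset_refl _) (by
          intro z; simp only [Set.mem_union, Set.mem_Iio, Set.mem_Ico]; omega), .inr h'⟩
      · have := slack (k + i) (by omega) h
          (by intro z; simp only [Set.mem_union, Set.mem_Iio, Set.mem_Ico]; omega)
          (by simp only [Set.mem_union, Set.mem_Iio, Set.mem_Ico]; omega)
        exact ⟨this.1, .inl this.2⟩
  have hll : ∀ i j, 0 < i → i ≤ j → j ≤ t →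
      Linked G c' (addEar H f m) (Set.Iio (k + t)) (f i) (f j) ∧
      Slack G c' (addEar H f m) (k + t) (f i) (f j) := fun i j hi hij hj =>
    slack k (by omega) (hc.left i j hij hj) (by intro z; simp only [Set.mem_Iio, Set.mem_Ico]; omega)
      (by simp only [Set.mem_Ico]; omega)
  have hrr : ∀ i j, i ≤ j → j < t →
      Linked G c' (addEar H f m) (Set.Iio (k + t)) (f (m - t + i)) (f (m - t + j)) ∧
      Slack G c' (addEar H f m) (k + t) (f (m - t + i)) (f (m - t + j)) := fun i j hij hj =>
    slack (k + j) (by omega) (hc.right i j hij hj.le)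
      (by intro z; simp only [Set.mem_Iio, Set.mem_Ico]; omega) (by simp only [Set.mem_Ico]; omega)
  rcases mem_addEar_cases ht ha with ha' | ⟨i, hi0, hit, rfl⟩ | ⟨i, hit, rfl⟩ <;>
    rcases mem_addEar_cases ht hb with hb' | ⟨j, hj0, hjt, rfl⟩ | ⟨j, hjt, rfl⟩
  · have := slack k (by omega) (hc.old (hH a ha' b hb'))
      (by intro z; simp only [Set.mem_Iio]; omega) (by simp)
    exact ⟨this.1, .inl this.2⟩
  · obtain ⟨h1, h2⟩ := hl a ha' j hjt
    exact ⟨h1, h2.imp_right fun h => .inl ⟨ha', .inl h⟩⟩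
  · obtain ⟨h1, h2⟩ := hr a ha' j hjt
    exact ⟨h1, h2.imp_right fun h => .inl ⟨ha', .inr h⟩⟩
  · obtain ⟨h1, h2⟩ := hl b hb' i hit
    exact ⟨h1.symm, h2.imp Slack.symm fun h => .inr (.inl ⟨hb', .inl h⟩)⟩
  · rcases le_total i j with h | h
    · exact ⟨(hll i j hi0 h hjt).1, .inl (hll i j hi0 h hjt).2⟩
    · exact ⟨(hll j i hj0 h hit).1.symm, .inl (hll j i hj0 h hit).2.symm⟩
  · obtain ⟨h1, h2⟩ := hlr i j hi0 hit hjt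
    exact ⟨h1, h2.imp_right fun h => .inr (.inr ⟨i, hi0, by omega, .inl ⟨rfl, by rw [h]⟩⟩)⟩
  · obtain ⟨h1, h2⟩ := hr b hb' i hit
    exact ⟨h1.symm, h2.imp Slack.symm fun h => .inr (.inl ⟨hb', .inr h⟩)⟩
  · obtain ⟨h1, h2⟩ := hlr j i hj0 hjt hit
    exact ⟨h1.symm, h2.imp Slack.symm
      fun h => .inr (.inr ⟨j, hj0, by omega, .inr ⟨rfl, by rw [h]⟩⟩)⟩
  · rcases le_total i j with h | h
    · exact ⟨(hrr i j h hjt).1, .inl (hrr i j h hjt).2⟩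
    · exact ⟨(hrr j i h hit).1.symm, .inl (hrr j i h hit).2.symm⟩

end EarColouring

/-- An ear with `m` edges can be added at the price of `⌊m / 2⌋` colours. A middle edge, present
for odd `m`, takes one of the old colours. -/
theorem IsEar.colourable (he : IsEar G H f m) (hm : 2 ≤ m) (hm' : m = 2 → f 0 ≠ f 2)
    (hk : 0 < k ∨ m % 2 = 0) (h : Colourable G H k) :
    Colourable G (addEar H f m) (k + m / 2) := by
  obtain ⟨c, hc⟩ := h
  obtain ⟨c', hc'⟩ := he.exists_earColouring hm hm' c k 0 rfl
  exact ⟨c', fun a ha b hb =>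
    (hc'.linked_or_slack he rfl hc (by omega) (by omega) ha hb).1⟩

/-- Adding an ear keeps a colouring ample: two pairs without slack between them would have to be
the two innermost vertices of the ear and two old vertices without slack to the ends of the ear. -/
theorem IsEar.ampleOn (he : IsEar G H f m) (hm : 2 ≤ m) (hm' : m = 2 → f 0 ≠ f 2)
    (hk : 0 < k ∨ m % 2 = 0) (hcl : f 0 = f m → ∀ a ∈ H, ∀ b ∈ H, a = b) (h : AmpleOn G c H k) :
    ∃ c', AmpleOn G c' (addEar H f m) (k + m / 2) := by
  obtain ⟨c', hc'⟩ := he.exists_earColouring hm hm' c k 0 rfl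
  have key := fun {a b} => hc'.linked_or_slack (a := a) (b := b) he rfl h.1 (by omega) (by omega)
  refine ⟨c', fun a ha b hb => (key ha hb).1, ?_⟩
  have hinj : ∀ i j, 0 < i → i < m → 0 < j → j < m → f i = f j → i = j := by
    intro i j hi him hj hjm hij
    rcases lt_trichotomy i j with h | h | h
    · exact absurd hij (he.inj i j hi h hjm)
    · exact h
    · exact absurd hij.symm (he.inj j i hj h him)
  have hout := he.out
  obtain ⟨t, htm⟩ : ∃ t, m / 2 = t := ⟨_, rfl⟩
  rw [htm] at key ⊢
  have htm1 : 1 ≤ t := by omega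
  have htm2 : 2 * t ≤ m := by omega
  -- a vertex without slack to two others is innermost, or the two others are
  have partner : ∀ a ∈ addEar H f m, ∀ b ∈ addEar H f m, ∀ b' ∈ addEar H f m, b ≠ b' →
      ¬ Slack G c' (addEar H f m) (k + t) a b → ¬ Slack G c' (addEar H f m) (k + t) a b' →
      (b ∈ H ∧ b' ∈ H ∧ (a = f t ∨ a = f (m - t))) ∨
      (a ∈ H ∧ b ∉ H ∧ b' ∉ H ∧ ¬ Slack G c H k a (f 0) ∧ ¬ Slack G c H k a (f m)) := by
    intro a ha b hb b' hb' hbb n n'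
    have hL := hout t (by omega) (by omega)
    have hR := hout (m - t) (by omega) (by omega)
    rcases (key ha hb).2.resolve_left n with
      ⟨h1, ⟨h2, h3⟩ | ⟨h2, h3⟩⟩ | ⟨h1, h2⟩ | ⟨i, hi, hit, ⟨h2, h3⟩ | ⟨h2, h3⟩⟩ <;>
    rcases (key ha hb').2.resolve_left n' with
      ⟨h1', ⟨h2', h3'⟩ | ⟨h2', h3'⟩⟩ | ⟨h1', h2'⟩ | ⟨i', hi', hit', ⟨h2', h3'⟩ | ⟨h2', h3'⟩⟩ <;>
    grind
  intro u₁ hu₁ v₁ hv₁ u₂ hu₂ v₂ hv₂ h1 h2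
  by_contra! hcon
  obtain ⟨n1, n2, n3, n4⟩ := hcon
  have s : ∀ {a b}, ¬ Slack G c' (addEar H f m) (k + t) a b →
    ¬ Slack G c' (addEar H f m) (k + t) b a := fun h h' => h h'.symm
  -- both members of the pair in the old part have no slack to either end of the ear
  have final : ∀ a ∈ H, ∀ b ∈ H, a ≠ b → ¬ Slack G c H k a (f 0) → ¬ Slack G c H k a (f m) →
      ¬ Slack G c H k b (f 0) → ¬ Slack G c H k b (f m) → False := by
    intro a ha b hb hab q1 q2 q3 q4
    by_cases h0 : f 0 = f m
    · exact hab (hcl h0 a ha b hb)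
    · rcases h.2 a ha b hb _ he.start _ he.finish hab h0 with q | q | q | q <;> contradiction
  have p1 := partner u₁ hu₁ u₂ hu₂ v₂ hv₂ h2 n1 n2
  have p2 := partner v₁ hv₁ u₂ hu₂ v₂ hv₂ h2 n3 n4
  have p3 := partner u₂ hu₂ u₁ hu₁ v₁ hv₁ h1 (s n1) (s n3)
  have p4 := partner v₂ hv₂ u₁ hu₁ v₁ hv₁ h1 (s n2) (s n4)
  have f1 := final u₁
  have f2 := final u₂
  grind

end

section

variable {V : Type*} [DecidableEq V] {G : SimpleGraph V} {c c' : Sym2 V → ℕ} {H S : Finset V}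
  {a b u v w x y : V} {k : ℕ}

/-! ### Adding single vertices -/

theorem Linked.update {A : Set ℕ} {i : ℕ} (h : Linked G c H A u v) (hw : w ∉ H) :
    Linked G (Function.update c s(w, y) i) H A u v := by
  refine h.congr fun a ha b hb => Function.update_of_ne (fun h => hw ?_) _ _
  rcases Sym2.eq_iff.1 h with ⟨rfl, -⟩ | ⟨-, rfl⟩ <;> assumption

/-- To see that `insert w H` is rainbow connected, only the pairs containing `w` matter. -/
theorem RainbowOn.insert (h : ∀ a ∈ H, ∀ b ∈ H, Linked G c (insert w H) (Set.Iio k) a b)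
    (hw : ∀ a ∈ H, Linked G c (insert w H) (Set.Iio k) w a) : RainbowOn G c (insert w H) k := by
  intro a ha b hb
  rcases Finset.mem_insert.1 ha with rfl | ha' <;> rcases Finset.mem_insert.1 hb with rfl | hb'
  · exact .refl ha
  · exact hw b hb'
  · exact (hw a ha').symm
  · exact h a ha' b hb'

theorem Colourable.insert (h : Colourable G H k) (hw : w ∉ H) (hu : u ∈ H) (hwu : G.Adj w u) :
    Colourable G (insert w H) (k + 1) := by
  obtain ⟨c, hc⟩ := h
  have old : ∀ a ∈ H, ∀ b ∈ H,
      Linked G (Function.update c s(w, u) k) (Insert.insert w H) (Set.Iio k) a b :=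
    fun a ha b hb => ((hc a ha b hb).update hw).mono (Finset.subset_insert _ _) (subset_refl _)
  refine ⟨Function.update c s(w, u) k, RainbowOn.insert (fun a ha b hb =>
    (old a ha b hb).mono (subset_refl _) (Set.Iio_subset_Iio (by omega))) fun a ha => ?_⟩
  refine (Linked.edge (A := {k}) (by simp) (by simp [hu]) hwu (by simp)).trans (old u hu a ha)
    (by simp) (by simp) (Set.Iio_subset_Iio (by omega))

/-- Two new vertices cost one colour `k` only: with `i` a colour missed on the way from `a` to `b`,
the walk from `w₁` to `w₂` leaves `w₁` towards `a` in colour `k` and enters `w₂` from `b` in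
colour `i`. -/
theorem AmpleOn.colourable_insert_insert {w₁ w₂ u₁ v₁ u₂ v₂ : V} (h : AmpleOn G c H k)
    (hw₁ : w₁ ∉ H) (hw₂ : w₂ ∉ H) (hw : w₁ ≠ w₂) (hu₁ : u₁ ∈ H) (hv₁ : v₁ ∈ H) (hu₂ : u₂ ∈ H)
    (hv₂ : v₂ ∈ H) (h₁ : u₁ ≠ v₁) (h₂ : u₂ ≠ v₂) (a₁ : G.Adj w₁ u₁) (b₁ : G.Adj w₁ v₁)
    (a₂ : G.Adj w₂ u₂) (b₂ : G.Adj w₂ v₂) : Colourable G (insert w₂ (insert w₁ H)) (k + 1) := by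
  have key : ∃ a ∈ H, ∃ b ∈ H, ∃ b' ∈ H, b ≠ b' ∧ G.Adj w₁ a ∧ G.Adj w₂ b ∧ G.Adj w₂ b' ∧
      Slack G c H k a b := by
    rcases h.2 u₁ hu₁ v₁ hv₁ u₂ hu₂ v₂ hv₂ h₁ h₂ with s | s | s | s
    · exact ⟨u₁, hu₁, u₂, hu₂, v₂, hv₂, h₂, a₁, a₂, b₂, s⟩
    · exact ⟨u₁, hu₁, v₂, hv₂, u₂, hu₂, h₂.symm, a₁, b₂, a₂, s⟩
    · exact ⟨v₁, hv₁, u₂, hu₂, v₂, hv₂, h₂, b₁, a₂, b₂, s⟩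
    · exact ⟨v₁, hv₁, v₂, hv₂, u₂, hu₂, h₂.symm, b₁, b₂, a₂, s⟩
  obtain ⟨a, ha, b, hb, b', hb', hbb, wa, wb, wb', i, hi, hab⟩ := key
  let d := Function.update (Function.update (Function.update c s(w₁, a) k) s(w₂, b') k) s(w₂, b) i
  have hsub : H ⊆ insert w₂ (insert w₁ H) :=
    (Finset.subset_insert _ _).trans (Finset.subset_insert _ _)
  have old : ∀ {A p q}, Linked G c H A p q → Linked G d (insert w₂ (insert w₁ H)) A p q :=
    fun hl => (((hl.update hw₁).update hw₂).update hw₂).mono hsub (subset_refl _)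
  have hne : ∀ z ∈ H, s(w₁, a) ≠ s(w₂, z) := by
    intro z hz he
    rcases Sym2.eq_iff.1 he with ⟨h, -⟩ | ⟨h, -⟩
    · exact hw h
    · exact hw₁ (h ▸ hz)
  have d1 : d s(w₁, a) = k := by
    simp [d, Function.update_of_ne (hne b hb), Function.update_of_ne (hne b' hb')]
  have d2 : d s(w₂, b') = k := by
    have : s(w₂, b') ≠ s(w₂, b) := fun h => hbb (Sym2.congr_right.1 h).symm
    simp [d, Function.update_of_ne this]
  have d3 : d s(w₂, b) = i := by simp [d]
  have e1 : Linked G d (insert w₂ (insert w₁ H)) {k} w₁ a :=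
    .edge (by simp) (by simp [ha]) wa (by simp [d1])
  have e2 : Linked G d (insert w₂ (insert w₁ H)) {k} w₂ b' :=
    .edge (by simp) (by simp [hb']) wb' (by simp [d2])
  have e3 : Linked G d (insert w₂ (insert w₁ H)) {i} w₂ b :=
    .edge (by simp) (by simp [hb]) wb (by simp [d3])
  have sub : Set.Iio k ⊆ Set.Iio (k + 1) := Set.Iio_subset_Iio (by omega)
  have l1 : ∀ y ∈ H, Linked G d (insert w₂ (insert w₁ H)) (Set.Iio (k + 1)) w₁ y := fun y hy =>
    e1.trans (old (h.1 a ha y hy)) (by simp) (by simp) sub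
  have l2 : ∀ y ∈ H, Linked G d (insert w₂ (insert w₁ H)) (Set.Iio (k + 1)) w₂ y := fun y hy =>
    e2.trans (old (h.1 b' hb' y hy)) (by simp) (by simp) sub
  have l0 : ∀ y ∈ H, ∀ z ∈ H, Linked G d (insert w₂ (insert w₁ H)) (Set.Iio (k + 1)) y z :=
    fun y hy z hz => (old (h.1 y hy z hz)).mono (subset_refl _) sub
  have l12 : Linked G d (insert w₂ (insert w₁ H)) (Set.Iio (k + 1)) w₁ w₂ := by
    refine (e1.trans (C := Set.Iio (k + 1) \ {i}) (old hab) ?_ ?_ ?_).trans e3.symm ?_ ?_ ?_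
    · simp
    · simp only [Set.singleton_subset_iff, Set.mem_sdiff, Set.mem_Iio, Set.mem_singleton_iff]
      omega
    · exact Set.sdiff_subset_sdiff_left sub
    · simp
    · exact Set.sdiff_subset
    · simp only [Set.singleton_subset_iff, Set.mem_Iio]
      omega
  refine ⟨d, RainbowOn.insert ?_ ?_⟩
  · intro y hy z hz
    rcases Finset.mem_insert.1 hy with rfl | hy' <;> rcases Finset.mem_insert.1 hz with rfl | hz'
    · exact .refl (by simp)
    · exact l1 z hz'
    · exact (l1 y hy').symm
    · exact l0 y hy' z hz'
  · intro y hy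
    rcases Finset.mem_insert.1 hy with rfl | hy'
    · exact l12.symm
    · exact l2 y hy'

/-- Any number of new vertices with two neighbours each in `H` cost two colours. -/
theorem Colourable.union_of_two_neighbours (h : Colourable G H k) (hHS : H ⊆ S)
    (hS : ∀ w ∈ S \ H, ∃ u ∈ H, ∃ v ∈ H, u ≠ v ∧ G.Adj w u ∧ G.Adj w v) :
    Colourable G S (k + 2) := by
  obtain ⟨c, hc⟩ := h
  choose! α hα β hβ hne hadj hadj' using hS
  let e : {w // w ∈ S \ H} × Bool → Sym2 V := fun p => s(p.1.1, cond p.2 (α p.1) (β p.1))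
  let g : {w // w ∈ S \ H} × Bool → ℕ := fun p => cond p.2 k (k + 1)
  have nb : ∀ p : {w // w ∈ S \ H} × Bool, cond p.2 (α p.1) (β p.1) ∈ H := by
    rintro ⟨w, _ | _⟩
    · exact hβ w w.2
    · exact hα w w.2
  have out : ∀ p : {w // w ∈ S \ H} × Bool, p.1.1 ∉ H := fun p => (Finset.mem_sdiff.1 p.1.2).2
  have hinj : Function.Injective e := by
    intro p q hpq
    rcases Sym2.eq_iff.1 hpq with ⟨h1, h2⟩ | ⟨h1, -⟩
    · obtain ⟨p, i⟩ := p
      obtain ⟨q, j⟩ := q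
      obtain rfl : p = q := Subtype.ext h1
      have := hne p p.2
      cases i <;> cases j <;> simp_all
    · exact absurd (h1 ▸ nb q) (out p)
  let d := Function.extend e g c
  have old : ∀ a ∈ H, ∀ b ∈ H, Linked G d S (Set.Iio k) a b := by
    intro a ha b hb
    refine ((hc a ha b hb).congr fun a ha b hb => ?_).mono hHS (subset_refl _)
    apply Function.extend_apply'
    rintro ⟨p, hp⟩
    rcases Sym2.eq_iff.1 hp with ⟨h, -⟩ | ⟨h, -⟩
    · exact out p (h ▸ ha)
    · exact out p (h ▸ hb)
  have e1 : ∀ w ∈ S \ H, Linked G d S {k} w (α w) := fun w hw =>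
    .edge (Finset.mem_sdiff.1 hw).1 (hHS (hα w hw)) (hadj w hw)
      (hinj.extend_apply g c (⟨w, hw⟩, true))
  have e2 : ∀ w ∈ S \ H, Linked G d S {k + 1} w (β w) := fun w hw =>
    .edge (Finset.mem_sdiff.1 hw).1 (hHS (hβ w hw)) (hadj' w hw)
      (hinj.extend_apply g c (⟨w, hw⟩, false))
  have l1 : ∀ w ∈ S \ H, ∀ y ∈ H, Linked G d S (Set.Iio (k + 1)) w y := fun w hw y hy =>
    (e1 w hw).trans (old _ (hα w hw) y hy) (by simp) (by simp) (Set.Iio_subset_Iio (by omega))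
  have sub : Set.Iio (k + 1) ⊆ Set.Iio (k + 2) := Set.Iio_subset_Iio (by omega)
  refine ⟨d, fun a ha b hb => ?_⟩
  by_cases haH : a ∈ H <;> by_cases hbH : b ∈ H
  · exact (old a haH b hbH).mono (subset_refl _) (Set.Iio_subset_Iio (by omega))
  · exact (l1 b (Finset.mem_sdiff.2 ⟨hb, hbH⟩) a haH).symm.mono (subset_refl _) sub
  · exact (l1 a (Finset.mem_sdiff.2 ⟨ha, haH⟩) b hbH).mono (subset_refl _) sub
  · have hb' := Finset.mem_sdiff.2 ⟨hb, hbH⟩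
    exact (l1 a (Finset.mem_sdiff.2 ⟨ha, haH⟩) _ (hβ b hb')).trans (e2 b hb').symm (by simp) sub
      (by simp)

/-! ### Finding ears in a 2-connected vertex set -/

/-- The subgraph induced by `S` is 2-connected: it has at least three vertices, is connected, and
stays connected when a vertex is deleted. Connectedness is expressed by an edge across every cut. -/
structure TwoConnectedOn (G : SimpleGraph V) (S : Finset V) : Prop where
  card : 3 ≤ S.card
  conn : ∀ A ⊆ S, A.Nonempty → A ≠ S → ∃ a ∈ A, ∃ b ∈ S \ A, G.Adj a b
  cut : ∀ x ∈ S, ∀ A ⊆ S.erase x, A.Nonempty → A ≠ S.erase x →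
    ∃ a ∈ A, ∃ b ∈ S.erase x \ A, G.Adj a b

/-- A path outside `H`, extended by an edge to `H` at both ends, is an ear. -/
theorem exists_isEar_of_walk {D : Finset V} {w₁ w₂ u₁ u₂ : V} (p : G.Walk w₁ w₂)
    (hp : ∀ z ∈ p.support, z ∈ D) (hD : Disjoint D H) (hu₁ : u₁ ∈ H) (hu₂ : u₂ ∈ H)
    (h₁ : G.Adj w₁ u₁) (h₂ : G.Adj w₂ u₂) (hw : w₁ ≠ w₂) :
    ∃ f m, IsEar G H f m ∧ 3 ≤ m ∧ (∀ i ≤ m, f i ∈ H ∨ f i ∈ D) ∧ f 0 = u₁ ∧ f m = u₂ := by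
  let q := p.bypass
  have hq : q.IsPath := p.bypass_isPath
  have hqD : ∀ i, q.getVert i ∈ D := fun i =>
    hp _ (p.support_bypass_subset_support (q.getVert_mem_support i))
  have hl : 1 ≤ q.length := by
    rcases Nat.eq_zero_or_pos q.length with h | h
    · exact absurd (Walk.eq_of_length_eq_zero h) hw
    · exact h
  let f : ℕ → V := fun i => if i = 0 then u₁ else if i ≤ q.length + 1 then q.getVert (i - 1) else u₂
  have f0 : f 0 = u₁ := by simp [f]
  have fm : f (q.length + 2) = u₂ := by simp [f]
  have fi : ∀ i, i ≤ q.length → f (i + 1) = q.getVert i := by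
    intro i hi
    simp [f, hi]
  have fi' : ∀ i, 0 < i → i < q.length + 2 → f i = q.getVert (i - 1) := by
    intro i hi hi'
    obtain ⟨i, rfl⟩ : ∃ j, i = j + 1 := ⟨i - 1, by omega⟩
    exact fi i (by omega)
  refine ⟨f, q.length + 2, ⟨f0 ▸ hu₁, fm ▸ hu₂, ?_, ?_, ?_⟩, by omega, ?_, f0, fm⟩
  · intro i hi
    rcases Nat.eq_zero_or_pos i with rfl | h0
    · rw [f0, fi 0 (by omega), q.getVert_zero]
      exact h₁.symm
    · rcases Nat.lt_or_ge i (q.length + 1) with h | h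
      · rw [fi' i h0 hi, fi i (by omega)]
        have := q.adj_getVert_succ (i := i - 1) (by omega)
        rwa [show i - 1 + 1 = i by omega] at this
      · obtain rfl : i = q.length + 1 := by omega
        rw [fi _ le_rfl, fm, q.getVert_length]
        exact h₂
  · intro i h0 hi
    rw [fi' i h0 hi]
    exact Finset.disjoint_left.1 hD (hqD _)
  · intro i j hi hij hj
    rw [fi' i hi (by omega), fi' j (by omega) hj]
    intro h
    have := hq.getVert_injOn (by simp only [Set.mem_ofPred_eq]; omega)
      (by simp only [Set.mem_ofPred_eq]; omega) h
    omega
  · intro i hi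
    rcases Nat.eq_zero_or_pos i with rfl | h0
    · exact .inl (f0 ▸ hu₁)
    · rcases hi.eq_or_lt with rfl | h
      · exact .inl (fm ▸ hu₂)
      · rw [fi' i h0 h]
        exact .inr (hqD _)

/-- In a 2-connected set, a neighbour `w` of `H` outside `H` either starts an ear with at least two
inner vertices, or has no neighbour outside `H` and two neighbours in `H`. The ends of the ear are
distinct unless `H` is a single vertex. -/
theorem TwoConnectedOn.exists_isEar_or (hS : TwoConnectedOn G S) (hHS : H ⊆ S) (hw : w ∈ S \ H)
    (hu : u ∈ H) (hwu : G.Adj w u) :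
    (∃ f m, IsEar G H f m ∧ 3 ≤ m ∧ (∀ i ≤ m, f i ∈ S) ∧ (f 0 = f m → ∀ a ∈ H, ∀ b ∈ H, a = b)) ∨
    ((∀ y ∈ S \ H, ¬ G.Adj w y) ∧ ∃ u ∈ H, ∃ v ∈ H, u ≠ v ∧ G.Adj w u ∧ G.Adj w v) := by
  classical
  -- the component of `w` outside `H`
  let C := (S \ H).filter fun y => ∃ p : G.Walk w y, ∀ z ∈ p.support, z ∈ S \ H
  have hwC : w ∈ C := Finset.mem_filter.2 ⟨hw, .nil, by simpa using hw⟩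
  have hC : C ⊆ S \ H := Finset.filter_subset _ _
  have step : ∀ a ∈ C, ∀ b ∈ S \ H, G.Adj a b → b ∈ C := by
    intro a ha b hb hab
    obtain ⟨p, hp⟩ := (Finset.mem_filter.1 ha).2
    refine Finset.mem_filter.2 ⟨hb, p.concat hab, fun z hz => ?_⟩
    rw [Walk.support_concat, List.mem_append, List.mem_singleton] at hz
    rcases hz with h | rfl
    · exact hp z h
    · exact hb
  have ear : ∀ w₁ ∈ C, ∀ w₂ ∈ C, w₁ ≠ w₂ → ∀ u₁ ∈ H, ∀ u₂ ∈ H, G.Adj w₁ u₁ → G.Adj w₂ u₂ →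
      (u₁ = u₂ → ∀ a ∈ H, ∀ b ∈ H, a = b) →
      ∃ f m, IsEar G H f m ∧ 3 ≤ m ∧ (∀ i ≤ m, f i ∈ S) ∧
        (f 0 = f m → ∀ a ∈ H, ∀ b ∈ H, a = b) := by
    intro w₁ hw₁ w₂ hw₂ hne u₁ hu₁ u₂ hu₂ h₁ h₂ h
    obtain ⟨p₁, hp₁⟩ := (Finset.mem_filter.1 hw₁).2
    obtain ⟨p₂, hp₂⟩ := (Finset.mem_filter.1 hw₂).2
    obtain ⟨f, m, he, hm, hf, h0, h1⟩ := exists_isEar_of_walk (H := H) (p₁.reverse.append p₂)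
      (D := S \ H) (fun z hz => by
        rw [Walk.mem_support_append_iff, Walk.support_reverse, List.mem_reverse] at hz
        exact hz.elim (hp₁ z) (hp₂ z)) Finset.sdiff_disjoint hu₁ hu₂ h₁ h₂ hne
    refine ⟨f, m, he, hm, fun i hi => ?_, by rwa [h0, h1]⟩
    exact (hf i hi).elim (fun h => hHS h) fun h => (Finset.mem_sdiff.1 h).1
  by_cases hex : ∃ w' ∈ C, w' ≠ w ∧ ∃ u' ∈ H, G.Adj w' u'
  · left
    obtain ⟨w', hw', hne, u', hu', hwu'⟩ := hex
    by_cases hsub : ∀ a ∈ H, ∀ b ∈ H, a = b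
    · exact ear w hwC w' hw' hne.symm u hu u' hu' hwu hwu' fun _ => hsub
    by_cases huu : u = u'
    · subst huu
      -- another vertex of `H` has a neighbour in `C`, since `u` does not separate `C` from it
      have hne' : C ≠ S.erase u := by
        rintro h
        refine hsub fun a ha b hb => ?_
        have : ∀ z ∈ H, z = u := by
          intro z hz
          by_contra hzu
          have : z ∈ C := h ▸ Finset.mem_erase.2 ⟨hzu, hHS hz⟩
          exact (Finset.mem_sdiff.1 (hC this)).2 hz
        rw [this a ha, this b hb]
      obtain ⟨a, ha, b, hb, hab⟩ := hS.cut u (hHS hu) C (fun z hz => by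
        have := Finset.mem_sdiff.1 (hC hz)
        exact Finset.mem_erase.2 ⟨fun h => this.2 (h ▸ hu), this.1⟩) ⟨w, hwC⟩ hne'
      simp only [Finset.mem_sdiff, Finset.mem_erase] at hb
      have hbH : b ∈ H := by
        by_contra hbH
        exact hb.2 (step a ha b (Finset.mem_sdiff.2 ⟨hb.1.2, hbH⟩) hab)
      by_cases haw : a = w
      · subst haw
        exact ear w' hw' a hwC hne u hu b hbH hwu' hab fun h => absurd h.symm hb.1.1
      · exact ear w hwC a ha (Ne.symm haw) u hu b hbH hwu hab fun h => absurd h.symm hb.1.1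
    · exact ear w hwC w' hw' hne.symm u hu u' hu' hwu hwu' fun h => absurd h huu
  · right
    push Not at hex
    have hwS := Finset.mem_sdiff.1 hw
    have hCw : ∀ y ∈ C, y = w := by
      by_contra! hy
      obtain ⟨y, hy, hyw⟩ := hy
      obtain ⟨a, ha, b, hb, hab⟩ := hS.cut w hwS.1 (C.erase w)
        (Finset.erase_subset_erase _ (hC.trans Finset.sdiff_subset))
        ⟨y, Finset.mem_erase.2 ⟨hyw, hy⟩⟩ (fun h => by
          have : u ∈ C.erase w := h ▸ Finset.mem_erase.2 ⟨fun h => hwS.2 (h ▸ hu), hHS hu⟩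
          exact (Finset.mem_sdiff.1 (hC (Finset.mem_of_mem_erase this))).2 hu)
      simp only [Finset.mem_sdiff, Finset.mem_erase] at ha hb
      by_cases hbH : b ∈ H
      · exact hex a ha.2 ha.1 b hbH hab
      · exact hb.2 ⟨hb.1.1, step a ha.2 b (Finset.mem_sdiff.2 ⟨hb.1.2, hbH⟩) hab⟩
    have hiso : ∀ y ∈ S \ H, ¬ G.Adj w y := fun y hy h =>
      h.ne (hCw y (step w hwC y hy h)).symm
    refine ⟨hiso, u, hu, ?_⟩
    have hwe : w ∈ S.erase u := Finset.mem_erase.2 ⟨fun h => hwS.2 (h ▸ hu), hwS.1⟩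
    obtain ⟨a, ha, b, hb, hab⟩ := hS.cut u (hHS hu) {w} (by simpa using hwe) (by simp) (by
      intro h
      have := congrArg Finset.card h
      rw [Finset.card_erase_of_mem (hHS hu), Finset.card_singleton] at this
      have := hS.card
      omega)
    rw [Finset.mem_singleton] at ha
    subst ha
    simp only [Finset.mem_sdiff, Finset.mem_erase] at hb
    refine ⟨b, ?_, hb.1.1.symm, hwu, hab⟩
    by_contra hbH
    exact hiso b (Finset.mem_sdiff.2 ⟨hb.1.2, hbH⟩) hab

/-- The subgraph induced by `S` satisfies the bound `rc ≤ (2 |S| - 2) / 3`. -/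
def Economical (G : SimpleGraph V) (S : Finset V) : Prop :=
  ∃ k, Colourable G S k ∧ 3 * k + 2 ≤ 2 * S.card

/-- An ample colouring of a part `H` with one third of a colour to spare extends to an economical
colouring of a 2-connected set: ears with at least two inner vertices never cost more than two
thirds of a colour per vertex, and when there are none left, the remaining vertices are independent
and have two neighbours each in `H`. -/
theorem TwoConnectedOn.economical_of_ampleOn (hS : TwoConnectedOn G S) (hHS : H ⊆ S)
    (hH : H.Nonempty) (hk : 0 < k) (hcard : 3 * k + 3 ≤ 2 * H.card) (h : AmpleOn G c H k) :
    Economical G S := by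
  induction hn : (S \ H).card using Nat.strong_induction_on generalizing H k c with
  | _ n ih =>
    subst hn
    by_cases hear : ∃ f m, IsEar G H f m ∧ 3 ≤ m ∧ (∀ i ≤ m, f i ∈ S) ∧
        (f 0 = f m → ∀ a ∈ H, ∀ b ∈ H, a = b)
    · obtain ⟨f, m, he, hm, hfS, hcl⟩ := hear
      obtain ⟨c', hc'⟩ := he.ampleOn (by omega) (by omega) (.inl hk) hcl h
      have hcard' := he.card_addEar
      have hsub : addEar H f m ⊆ S := by
        intro z hz
        rcases mem_addEar.1 hz with h | ⟨i, -, hi, rfl⟩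
        · exact hHS h
        · exact hfS i hi.le
      refine ih _ ?_ hsub (hH.mono Finset.subset_union_left) (by omega) (by omega) hc' rfl
      rw [Finset.card_sdiff_of_subset hsub, Finset.card_sdiff_of_subset hHS, hcard']
      have := Finset.card_le_card hsub
      omega
    have two : ∀ w ∈ S \ H, (∃ u ∈ H, G.Adj w u) → (∀ y ∈ S \ H, ¬ G.Adj w y) ∧
        ∃ u ∈ H, ∃ v ∈ H, u ≠ v ∧ G.Adj w u ∧ G.Adj w v := by
      rintro w hw ⟨u, hu, hwu⟩
      exact (hS.exists_isEar_or hHS hw hu hwu).resolve_left hear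
    have nb : ∀ w ∈ S \ H, ∃ u ∈ H, G.Adj w u := by
      classical
      by_contra! hno
      obtain ⟨w, hw, hwH⟩ := hno
      obtain ⟨a, ha, b, hb, hab⟩ := hS.conn ((S \ H).filter fun w => ∀ u ∈ H, ¬ G.Adj w u)
        ((Finset.filter_subset _ _).trans Finset.sdiff_subset)
        ⟨w, Finset.mem_filter.2 ⟨hw, hwH⟩⟩ (by
          intro h
          obtain ⟨x, hx⟩ := hH
          have : x ∈ S := hHS hx
          rw [← h] at this
          exact (Finset.mem_sdiff.1 (Finset.mem_filter.1 this).1).2 hx)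
      obtain ⟨haS, haH⟩ := Finset.mem_filter.1 ha
      obtain ⟨hbS, hb'⟩ := Finset.mem_sdiff.1 hb
      have hbH : b ∉ H := fun hbH => haH b hbH hab
      have hbSH := Finset.mem_sdiff.2 ⟨hbS, hbH⟩
      have : ∃ u ∈ H, G.Adj b u := by
        by_contra! hno
        exact hb' (Finset.mem_filter.2 ⟨hbSH, hno⟩)
      exact (two b hbSH this).1 a haS hab.symm
    have hcS : S.card = H.card + (S \ H).card := by
      rw [Finset.card_sdiff_of_subset hHS]
      have := Finset.card_le_card hHS
      omega
    have hSu : H ∪ S \ H = S := Finset.union_sdiff_of_subset hHS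
    rcases Nat.lt_or_ge (S \ H).card 3 with hlt | hge
    · obtain h0 | h1 | h2 : (S \ H).card = 0 ∨ (S \ H).card = 1 ∨ (S \ H).card = 2 := by omega
      · rw [Finset.card_eq_zero] at h0
        rw [h0, Finset.union_empty] at hSu
        subst hSu
        exact ⟨k, ⟨c, h.1⟩, by omega⟩
      · obtain ⟨w, hw⟩ := Finset.card_eq_one.1 h1
        have hwS : w ∈ S \ H := by simp [hw]
        obtain ⟨u, hu, hwu⟩ := nb w hwS
        refine ⟨k + 1, ?_, by omega⟩
        rw [← hSu, hw, Finset.union_comm]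
        exact Colourable.insert ⟨c, h.1⟩ (Finset.mem_sdiff.1 hwS).2 hu hwu
      · obtain ⟨w₁, w₂, hne, hw⟩ := Finset.card_eq_two.1 h2
        have hw₁ : w₁ ∈ S \ H := by simp [hw]
        have hw₂ : w₂ ∈ S \ H := by simp [hw]
        obtain ⟨u₁, hu₁, v₁, hv₁, h₁, a₁, b₁⟩ := (two w₁ hw₁ (nb w₁ hw₁)).2
        obtain ⟨u₂, hu₂, v₂, hv₂, h₂, a₂, b₂⟩ := (two w₂ hw₂ (nb w₂ hw₂)).2
        refine ⟨k + 1, ?_, by omega⟩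
        have := h.colourable_insert_insert (Finset.mem_sdiff.1 hw₁).2 (Finset.mem_sdiff.1 hw₂).2
          hne hu₁ hv₁ hu₂ hv₂ h₁ h₂ a₁ b₁ a₂ b₂
        convert this using 1
        rw [← hSu, hw]
        ext z
        simp only [Finset.mem_union, Finset.mem_insert, Finset.mem_singleton]
        tauto
    · exact ⟨k + 2, Colourable.union_of_two_neighbours ⟨c, h.1⟩ hHS
        fun w hw => (two w hw (nb w hw)).2, by omega⟩

end

section

variable {V : Type*} [DecidableEq V] {G : SimpleGraph V} {S : Finset V} {a b d w x y : V}
  {t m : ℕ} {f : ℕ → V}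

/-! ### Ample colourings of small sets and of cycles -/

theorem ampleOn_triangle (hab : G.Adj a b) (hbd : G.Adj b d) (hda : G.Adj d a) :
    AmpleOn G (fun _ => 0) {a, b, d} 1 := by
  have hadj : ∀ p ∈ ({a, b, d} : Finset V), ∀ q ∈ ({a, b, d} : Finset V), p ≠ q → G.Adj p q := by
    have := hab.symm
    have := hbd.symm
    have := hda.symm
    simp only [Finset.mem_insert, Finset.mem_singleton]
    rintro p (rfl | rfl | rfl) q (rfl | rfl | rfl) hpq <;> first | assumption | exact absurd rfl hpq
  constructor
  · intro p hp q hq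
    by_cases hpq : p = q
    · exact hpq ▸ .refl hp
    · exact .edge hp hq (hadj p hp q hq hpq) (by simp)
  · -- two pairs in a set of three vertices meet
    intro u₁ hu₁ v₁ hv₁ u₂ hu₂ v₂ hv₂ h₁ h₂
    have : u₁ = u₂ ∨ u₁ = v₂ ∨ v₁ = u₂ ∨ v₁ = v₂ := by
      simp only [Finset.mem_insert, Finset.mem_singleton] at hu₁ hv₁ hu₂ hv₂
      grind
    rcases this with rfl | rfl | rfl | rfl
    · exact .inl (.refl one_pos hu₁)
    · exact .inr (.inl (.refl one_pos hu₁))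
    · exact .inr (.inr (.inl (.refl one_pos hv₁)))
    · exact .inr (.inr (.inr (.refl one_pos hv₁)))

/-- Two vertices `a`, `d` with three common neighbours: the pairs of colours on the edges from
`x`, `y`, `w` to `a`, `d` are `01`, `10`, `00`. -/
theorem exists_ampleOn_of_common_neighbours (hax : G.Adj a x) (hay : G.Adj a y) (haw : G.Adj a w)
    (hdx : G.Adj d x) (hdy : G.Adj d y) (hdw : G.Adj d w) (had : a ≠ d) (hxy : x ≠ y)
    (hxw : x ≠ w) (hyw : y ≠ w) : ∃ c, AmpleOn G c {a, d, x, y, w} 2 := by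
  let c : Sym2 V → ℕ := fun e => if e = s(d, x) ∨ e = s(a, y) then 1 else 0
  have c1 : c s(a, x) = 0 := by simp [c, had, hxy, hay.ne, hax.ne]
  have c2 : c s(d, x) = 1 := by simp [c]
  have c3 : c s(a, y) = 1 := by simp [c]
  have c4 : c s(d, y) = 0 := by simp [c, had.symm, hxy.symm, hdy.ne, hdx.ne]
  have c5 : c s(a, w) = 0 := by simp [c, had, hyw.symm, hay.ne, hax.ne]
  have c6 : c s(d, w) = 0 := by simp [c, had.symm, hxw.symm, hdx.ne, hdy.ne]
  have c1' : c s(x, a) = 0 := by rwa [Sym2.eq_swap]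
  have c2' : c s(x, d) = 1 := by rwa [Sym2.eq_swap]
  have c3' : c s(y, a) = 1 := by rwa [Sym2.eq_swap]
  have c4' : c s(y, d) = 0 := by rwa [Sym2.eq_swap]
  have two : ∀ p q z, p ∈ ({a, d, x, y, w} : Finset V) → q ∈ ({a, d, x, y, w} : Finset V) →
      z ∈ ({a, d, x, y, w} : Finset V) → G.Adj p z → G.Adj z q → c s(p, z) ≠ c s(z, q) →
      Linked G c {a, d, x, y, w} (Set.Iio 2) p q := by
    intro p q z hp hq hz h1 h2 hne
    have lt : ∀ e, c e < 2 := by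
      intro e
      simp only [c]
      split <;> omega
    exact (Linked.edge (A := {c s(p, z)}) hp hz h1 rfl).trans
      (Linked.edge (A := {c s(z, q)}) hz hq h2 rfl) (by simpa using hne)
      (by simpa using lt _) (by simpa using lt _)
  have hsl : ∀ p ∈ ({a, d} : Finset V), ∀ q ∈ ({x, y, w} : Finset V),
      Slack G c {a, d, x, y, w} 2 p q := by
    simp only [Finset.mem_insert, Finset.mem_singleton]
    rintro p (rfl | rfl) q (rfl | rfl | rfl) <;>
      exact .of_edge le_rfl (by simp) (by simp) (by assumption) (by omega)
  have e : ∀ p ∈ ({a, d} : Finset V), ∀ q ∈ ({x, y, w} : Finset V),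
      Linked G c {a, d, x, y, w} (Set.Iio 2) p q := fun p hp q hq =>
    let ⟨_, _, h⟩ := hsl p hp q hq
    h.mono (subset_refl _) Set.sdiff_subset
  have l1 := two a d x (by simp) (by simp) (by simp) hax hdx.symm (by omega)
  have l2 := two x y a (by simp) (by simp) (by simp) hax.symm hay (by omega)
  have l3 := two x w d (by simp) (by simp) (by simp) hdx.symm hdw (by omega)
  have l4 := two y w a (by simp) (by simp) (by simp) hay.symm haw (by omega)
  have cases : ∀ p ∈ ({a, d, x, y, w} : Finset V),
      p ∈ ({a, d} : Finset V) ∨ p ∈ ({x, y, w} : Finset V) := by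
    intro p
    simp only [Finset.mem_insert, Finset.mem_singleton]
    tauto
  refine ⟨c, ?_, ?_⟩
  · intro p hp q hq
    rcases cases p hp with hp' | hp' <;> rcases cases q hq with hq' | hq'
    · simp only [Finset.mem_insert, Finset.mem_singleton] at hp' hq'
      rcases hp' with rfl | rfl <;> rcases hq' with rfl | rfl <;>
        first | exact .refl hp | exact l1 | exact l1.symm
    · exact e p hp' q hq'
    · exact (e q hq' p hp').symm
    · simp only [Finset.mem_insert, Finset.mem_singleton] at hp' hq'
      rcases hp' with rfl | rfl | rfl <;> rcases hq' with rfl | rfl | rfl <;>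
        first | exact .refl hp | exact l2 | exact l2.symm | exact l3 | exact l3.symm | exact l4 |
          exact l4.symm
  · -- without adjacent vertices, the two pairs lie on the same side and meet
    intro u₁ hu₁ v₁ hv₁ u₂ hu₂ v₂ hv₂ h₁ h₂
    have key : ∀ p ∈ ({a, d, x, y, w} : Finset V), ∀ q ∈ ({a, d, x, y, w} : Finset V),
        ¬ Slack G c {a, d, x, y, w} 2 p q → p ≠ q ∧
        ((p = a ∨ p = d) ∧ (q = a ∨ q = d) ∨
          (p = x ∨ p = y ∨ p = w) ∧ (q = x ∨ q = y ∨ q = w)) := by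
      intro p hp q hq hn
      refine ⟨fun h => hn (h ▸ .refl two_pos hp), ?_⟩
      rcases cases p hp with hp' | hp' <;> rcases cases q hq with hq' | hq'
      · left; simpa using And.intro hp' hq'
      · exact absurd (hsl p hp' q hq') hn
      · exact absurd (hsl q hq' p hp').symm hn
      · right; simpa using And.intro hp' hq'
    by_contra! hcon
    obtain ⟨n1, n2, n3, n4⟩ := hcon
    have k1 := key _ hu₁ _ hu₂ n1
    have k2 := key _ hu₁ _ hv₂ n2
    have k3 := key _ hv₁ _ hu₂ n3
    have k4 := key _ hv₁ _ hv₂ n4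
    have := hax.ne
    have := hay.ne
    have := haw.ne
    have := hdx.ne
    have := hdy.ne
    have := hdw.ne
    grind

/-- The vertices of a cycle. -/
def cycleVerts (f : ℕ → V) (m : ℕ) : Finset V := (Finset.range m).image f

theorem mem_cycleVerts : x ∈ cycleVerts f m ↔ ∃ i < m, f i = x := by
  simp [cycleVerts]

namespace IsCycleMap

theorem addEar_eq (_ : IsCycleMap G f m) (hm : 0 < m) : addEar {f 0} f m = cycleVerts f m := by
  ext z
  rw [mem_addEar, mem_cycleVerts, Finset.mem_singleton]
  constructor
  · rintro (rfl | ⟨i, -, hi, rfl⟩)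
    · exact ⟨0, hm, rfl⟩
    · exact ⟨i, hi, rfl⟩
  · rintro ⟨i, hi, rfl⟩
    rcases Nat.eq_zero_or_pos i with rfl | h0
    · exact .inl rfl
    · exact .inr ⟨i, h0, hi, rfl⟩

theorem card_cycleVerts (h : IsCycleMap G f m) : (cycleVerts f m).card = m := by
  rw [cycleVerts, Finset.card_image_of_injOn, Finset.card_range]
  intro i hi j hj hij
  exact h.injOn (by simpa using hi) (by simpa using hj) hij

/-- A cycle can be started at any of its vertices. -/
theorem exists_rotation (h : IsCycleMap G f m) (hx : x ∈ cycleVerts f m) :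
    ∃ g, IsCycleMap G g m ∧ g 0 = x ∧ cycleVerts g m = cycleVerts f m := by
  obtain ⟨i, hi, rfl⟩ := mem_cycleVerts.1 hx
  have hm : 0 < m := by omega
  have hinj : ∀ p q, p < q → q < m → (i + p) % m ≠ (i + q) % m := by
    intro p q hpq hq h
    have h' : p ≡ q [MOD m] := Nat.ModEq.add_left_cancel' i h
    rw [Nat.ModEq, Nat.mod_eq_of_lt (by omega), Nat.mod_eq_of_lt hq] at h'
    omega
  have hg : IsCycleMap G (fun j => f ((i + j) % m)) m := by
    refine ⟨by simp, fun j hj => ?_, fun p q hpq hq h' =>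
      hinj p q hpq hq (h.injOn (Nat.mod_lt _ hm) (Nat.mod_lt _ hm) h')⟩
    have hlt := Nat.mod_lt (i + j) hm
    have := h.adj _ hlt
    rw [← add_assoc]
    rcases Nat.lt_or_ge ((i + j) % m + 1) m with h' | h'
    · have : (i + j + 1) % m = (i + j) % m + 1 := by
        rw [← Nat.mod_add_mod, Nat.mod_eq_of_lt h']
      rwa [this]
    · have he : (i + j) % m + 1 = m := by omega
      rw [he, h.closed] at this
      have : (i + j + 1) % m = 0 := by
        rw [← Nat.mod_add_mod, he, Nat.mod_self]
      rwa [this]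
  refine ⟨_, hg, by simp [Nat.mod_eq_of_lt hi], ?_⟩
  refine Finset.eq_of_subset_of_card_le ?_ (by rw [hg.card_cycleVerts, h.card_cycleVerts])
  intro z hz
  obtain ⟨j, -, rfl⟩ := mem_cycleVerts.1 hz
  exact mem_cycleVerts.2 ⟨_, Nat.mod_lt _ hm, rfl⟩

/-- An odd cycle with one further vertex `w` attached is coloured with no more colours than the
cycle alone: from `f 0`, all of the cycle is reached without the colour `0` of the middle edge, so
that this colour can be used again on the edge from `f 0` to `w`. -/
theorem exists_ampleOn_insert (h : IsCycleMap G f m) (ht : m = 2 * t + 1) (ht1 : 1 ≤ t)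
    (hw : w ∉ cycleVerts f m) (hadj : G.Adj w (f 0)) :
    ∃ c, AmpleOn G c (insert w (cycleVerts f m)) (1 + t) := by
  have he := h.isEar
  have htm : t = m / 2 := by omega
  obtain ⟨c, hc⟩ := he.exists_earColouring (by omega) (by omega) (fun _ => 0) 1 0 htm
  have hr := rainbowOn_singleton (G := G) (c := fun _ => 0) (k := 1) (f 0)
  have base : ∀ z ∈ addEar {f 0} f m,
      Linked G c (addEar {f 0} f m) (Set.Ico 1 (1 + t)) (f 0) z := by
    intro z hz
    have h0 : Linked G (fun _ => 0) {f 0} ∅ (f 0) (f 0) := .refl (by simp)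
    rcases mem_addEar_cases htm hz with h' | ⟨i, -, hi, rfl⟩ | ⟨j, hj, rfl⟩
    · rw [Finset.mem_singleton.1 h']
      exact .refl (Finset.mem_union_left _ (by simp))
    · refine (hc.old_left (Set.empty_subset _) hi h0).mono (subset_refl _) ?_
      intro z; simp only [Set.mem_union, Set.mem_empty_iff_false, false_or, Set.mem_Ico]; omega
    · have h1 : Linked G (fun _ => 0) {f 0} ∅ (f 0) (f m) := h.closed ▸ h0
      refine (hc.old_right (by omega) (Set.empty_subset _) hj.le h1).mono (subset_refl _) ?_
      intro z; simp only [Set.mem_union, Set.mem_empty_iff_false, false_or, Set.mem_Ico]; omega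
  have noZero : ∀ {p q}, Linked G c (addEar {f 0} f m) (Set.Ico 1 (1 + t)) p q →
      Slack G c (addEar {f 0} f m) (1 + t) p q := fun hl => ⟨0, by omega, hl.mono (subset_refl _) (by
        intro z; simp only [Set.mem_sdiff, Set.mem_singleton_iff, Set.mem_Ico, Set.mem_Iio]; omega)⟩
  have slack : ∀ p ∈ addEar {f 0} f m, ∀ q ∈ addEar {f 0} f m,
      Slack G c (addEar {f 0} f m) (1 + t) p q := by
    have outer : ∀ i, i < t → Slack G c (addEar {f 0} f m) (1 + t) (f i) (f (m - t + i)) := by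
      intro i hi
      refine noZero ((hc.left_right_outer (by omega) (Set.empty_subset _) (h.closed ▸ .refl (by simp))
        le_rfl hi.le).mono (subset_refl _) ?_)
      intro z; simp only [Set.mem_union, Set.mem_empty_iff_false, or_false, Set.mem_Ico]; omega
    intro p hp q hq
    rcases (hc.linked_or_slack he htm hr ht1 (by omega) hp hq).2 with
      h' | ⟨h', -⟩ | ⟨h', -⟩ | ⟨i, -, hi, ⟨rfl, rfl⟩ | ⟨rfl, rfl⟩⟩
    · exact h'
    · rw [Finset.mem_singleton.1 h']
      exact noZero (base q hq)
    · rw [Finset.mem_singleton.1 h']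
      exact (noZero (base p hp)).symm
    · exact outer i hi
    · exact (outer i hi).symm
  rw [h.addEar_eq (by omega)] at base slack
  have lift : ∀ {A p q}, Linked G c (cycleVerts f m) A p q →
      Linked G (Function.update c s(w, f 0) 0) (insert w (cycleVerts f m)) A p q :=
    fun hl => (hl.update hw).mono (Finset.subset_insert _ _) (subset_refl _)
  have f0 : f 0 ∈ cycleVerts f m := mem_cycleVerts.2 ⟨0, by omega, rfl⟩
  refine ⟨Function.update c s(w, f 0) 0, RainbowOn.insert (fun p hp q hq => ?_) fun p hp => ?_, ?_⟩
  · obtain ⟨_, _, hl⟩ := slack p hp q hq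
    exact lift (hl.mono (subset_refl _) Set.sdiff_subset)
  · refine (Linked.edge (A := {0}) (by simp) (by simp [f0]) hadj (by simp)).trans
      (lift (base p hp)) ?_ ?_ ?_
    · simp
    · simp
    · intro z; simp only [Set.mem_Ico, Set.mem_Iio]; omega
  · intro u₁ hu₁ v₁ hv₁ u₂ hu₂ v₂ hv₂ h₁ h₂
    have sl : ∀ p ∈ cycleVerts f m, ∀ q ∈ cycleVerts f m, Slack G (Function.update c s(w, f 0) 0)
        (insert w (cycleVerts f m)) (1 + t) p q := fun p hp q hq =>
      let ⟨i, hi, hl⟩ := slack p hp q hq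
      ⟨i, hi, lift hl⟩
    rw [Finset.mem_insert] at hu₁ hv₁ hu₂ hv₂
    -- each pair contains a vertex of the cycle
    grind

end IsCycleMap

/-! ### 2-connected vertex sets -/

theorem TwoConnectedOn.economical_of_triangle (hS : TwoConnectedOn G S) (ha : a ∈ S) (hb : b ∈ S)
    (hd : d ∈ S) (hab : G.Adj a b) (hbd : G.Adj b d) (hda : G.Adj d a) : Economical G S := by
  refine hS.economical_of_ampleOn ?_ (by simp) one_pos ?_ (ampleOn_triangle hab hbd hda)
  · simp [Finset.insert_subset_iff, ha, hb, hd]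
  · simp [Finset.card_eq_three.2 ⟨a, b, d, hab.ne, hda.ne.symm, hbd.ne, rfl⟩]

/-- Cycles of length at least five leave a third of a colour to spare, after the attachment of one
further vertex if the length is odd. -/
theorem TwoConnectedOn.economical_of_cycle (hS : TwoConnectedOn G S) (hf : IsCycleMap G f m)
    (hfS : cycleVerts f m ⊆ S) (hm : 5 ≤ m) (h5 : m = 5 → cycleVerts f m ≠ S) :
    Economical G S := by
  have hne : (cycleVerts f m).Nonempty := ⟨f 0, mem_cycleVerts.2 ⟨0, by omega, rfl⟩⟩
  rcases Nat.even_or_odd' m with ⟨t, ht | ht⟩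
  · obtain ⟨c, hc⟩ := hf.isEar.ampleOn (k := 0) (c := fun _ => 0) (by omega) (by omega) (by omega)
      (fun _ => by simp) (ampleOn_singleton _)
    rw [hf.addEar_eq (by omega)] at hc
    exact hS.economical_of_ampleOn hfS hne (by omega) (by rw [hf.card_cycleVerts]; omega) hc
  · by_cases hfS' : cycleVerts f m = S
    · have hm5 : m ≠ 5 := fun h => h5 h hfS'
      refine ⟨1 + m / 2, ?_, by rw [← hfS', hf.card_cycleVerts]; omega⟩
      rw [← hfS', ← hf.addEar_eq (by omega)]
      exact hf.isEar.colourable (by omega) (by omega) (by omega)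
        ⟨fun _ => 0, rainbowOn_singleton _⟩
    · obtain ⟨a, ha, w, hw, haw⟩ := hS.conn _ hfS hne hfS'
      obtain ⟨hwS, hwf⟩ := Finset.mem_sdiff.1 hw
      obtain ⟨g, hg, rfl, hgf⟩ := hf.exists_rotation ha
      rw [← hgf] at hwf
      obtain ⟨c, hc⟩ := hg.exists_ampleOn_insert ht (by omega) hwf haw.symm
      refine hS.economical_of_ampleOn (Finset.insert_subset hwS (hgf ▸ hfS)) (by simp) (by omega) ?_ hc
      rw [Finset.card_insert_of_notMem hwf, hg.card_cycleVerts]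
      omega

/-- A cycle of length four spans an economical set, or lies in a set of two vertices with three
common neighbours, or has an ear that gives a triangle or a longer cycle. -/
theorem TwoConnectedOn.economical_of_four_cycle (hS : TwoConnectedOn G S) (hf : IsCycleMap G f 4)
    (hfS : cycleVerts f 4 ⊆ S) : Economical G S := by
  by_cases hfS' : cycleVerts f 4 = S
  · refine ⟨0 + 4 / 2, ?_, by rw [← hfS', hf.card_cycleVerts]⟩
    rw [← hfS', ← hf.addEar_eq (by omega)]
    exact hf.isEar.colourable (by omega) (by omega) (by omega) ⟨fun _ => 0, rainbowOn_singleton _⟩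
  have hear : ∃ g M, IsEar G (cycleVerts f 4) g M ∧ 2 ≤ M ∧ (∀ i ≤ M, g i ∈ S) ∧ g 0 ≠ g M := by
    obtain ⟨a, ha, w, hw, haw⟩ := hS.conn _ hfS ⟨f 0, mem_cycleVerts.2 ⟨0, by omega, rfl⟩⟩ hfS'
    rcases hS.exists_isEar_or hfS hw ha haw.symm with
      ⟨g, M, he, hM, hgS, hcl⟩ | ⟨-, u, hu, v, hv, huv, hwu, hwv⟩
    · refine ⟨g, M, he, by omega, hgS, fun h => ?_⟩
      exact hf.inj 0 1 (by omega) (by omega) (hcl h _ (mem_cycleVerts.2 ⟨0, by omega, rfl⟩) _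
        (mem_cycleVerts.2 ⟨1, by omega, rfl⟩))
    · obtain ⟨hwS, hwf⟩ := Finset.mem_sdiff.1 hw
      refine ⟨fun i => if i = 0 then u else if i = 1 then w else v, 2,
        ⟨by simpa using hu, by simpa using hv, ?_, ?_, ?_⟩, le_rfl, ?_, by simpa using huv⟩
      · intro i hi
        interval_cases i
        · simpa using hwu.symm
        · simpa using hwv
      · intro i h0 hi
        obtain rfl : i = 1 := by omega
        simpa using hwf
      · omega
      · intro i _
        dsimp only
        split_ifs
        · exact hfS hu
        · exact hwS
        · exact hfS hv
  obtain ⟨g, M, he, hM, hgS, hne⟩ := hear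
  obtain ⟨f', hf', h0, hff'⟩ := hf.exists_rotation he.start
  rw [← hff'] at he hfS
  clear hf hfS' hff'
  have mem : ∀ i ≤ 4, f' i ∈ cycleVerts f' 4 := by
    intro i hi
    rcases hi.eq_or_lt with rfl | h
    · rw [hf'.closed]
      exact mem_cycleVerts.2 ⟨0, by omega, rfl⟩
    · exact mem_cycleVerts.2 ⟨i, h, rfl⟩
  have cyc : ∀ {r : ℕ → V} {L : ℕ}, r 0 = g M → r L = g 0 → (∀ i ≤ L, r i ∈ cycleVerts f' 4) →
      (∀ i < L, G.Adj (r i) (r (i + 1))) → (∀ i j, i < j → j ≤ L → r i ≠ r j) → 5 ≤ M + L →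
      (M + L = 5 → ∃ z ∈ cycleVerts f' 4, z ≠ g 0 ∧ ∀ i ≤ L, r i ≠ z) → Economical G S := by
    intro r L hr0 hrL hrH hradj hrinj hML h5
    refine hS.economical_of_cycle (IsCycleMap.of_isEar he (by omega) hr0 hrL hrH hradj hrinj) ?_
      hML ?_
    · intro z hz
      obtain ⟨i, hi, rfl⟩ := mem_cycleVerts.1 hz
      split_ifs
      · exact hgS i (by omega)
      · exact hfS (hrH _ (by omega))
    · intro h heq
      obtain ⟨z, hz, hz0, hzr⟩ := h5 h
      have := hfS hz
      rw [← heq] at this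
      obtain ⟨i, hi, hiz⟩ := mem_cycleVerts.1 this
      split_ifs at hiz with hiM
      · rcases Nat.eq_zero_or_pos i with rfl | hi0
        · exact hz0 hiz.symm
        · exact he.out i hi0 hiM (hiz ▸ hz)
      · exact hzr _ (by omega) hiz
  have hinj : ∀ i j, i < j → j ≤ 4 → 0 < i → f' i ≠ f' j := by
    intro i j hij hj hi
    rcases hj.eq_or_lt with rfl | h
    · rw [hf'.closed]
      exact (hf'.inj 0 i hi hij).symm
    · exact hf'.inj i j hij h
  obtain ⟨i, hi, hgM⟩ := mem_cycleVerts.1 he.finish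
  have hi0 : i ≠ 0 := by
    rintro rfl
    exact hne (h0.symm.trans hgM)
  have tri : M = 2 → G.Adj (g M) (g 0) → Economical G S := by
    rintro rfl hadj
    exact hS.economical_of_triangle (hgS 0 (by omega)) (hgS 1 (by omega)) (hgS 2 (by omega))
      (he.adj 0 (by omega)) (he.adj 1 (by omega)) hadj
  obtain rfl | rfl | rfl : i = 1 ∨ i = 2 ∨ i = 3 := by omega
  · by_cases hM2 : M = 2
    · refine tri hM2 ?_
      rw [← hgM, ← h0]
      exact (hf'.adj 0 (by omega)).symm
    · refine cyc (r := fun i => f' (1 + i)) (L := 3) hgM (hf'.closed.trans h0)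
        (fun i hi => mem _ (by omega)) (fun i hi => hf'.adj (1 + i) (by omega))
        (fun i j hij hj => hinj _ _ (by omega) (by omega) (by omega)) (by omega) (by omega)
  · by_cases hM2 : M = 2
    · -- `f' 0` and `f' 2` have the common neighbours `f' 1`, `f' 3` and `g 1`
      subst hM2
      have hout := he.out 1 (by omega) (by omega)
      have hne' : ∀ i ≤ 4, f' i ≠ g 1 := fun i hi h => hout (h ▸ mem i hi)
      have a3 := hf'.adj 3 (by omega)
      rw [hf'.closed] at a3
      have b1 := he.adj 0 (by omega)
      have b2 := he.adj 1 (by omega)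
      rw [← h0] at b1
      rw [← hgM] at b2
      obtain ⟨c, hc⟩ := exists_ampleOn_of_common_neighbours (hf'.adj 0 (by omega)) a3.symm b1
        (hf'.adj 1 (by omega)).symm (hf'.adj 2 (by omega)) b2.symm
        (hf'.inj 0 2 (by omega) (by omega)) (hf'.inj 1 3 (by omega) (by omega))
        (hne' 1 (by omega)) (hne' 3 (by omega))
      refine hS.economical_of_ampleOn ?_ (by simp) two_pos ?_ hc
      · have := fun i hi => hfS (mem i hi)
        simp [Finset.insert_subset_iff, this, hgS]
      · have h1 := hf'.inj 0 1 (by omega) (by omega)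
        have h2 := hf'.inj 0 2 (by omega) (by omega)
        have h3 := hf'.inj 0 3 (by omega) (by omega)
        have h4 := hf'.inj 1 2 (by omega) (by omega)
        have h5 := hf'.inj 1 3 (by omega) (by omega)
        have h6 := hf'.inj 2 3 (by omega) (by omega)
        have h7 := hne' 0 (by omega)
        have h8 := hne' 1 (by omega)
        have h9 := hne' 2 (by omega)
        have h10 := hne' 3 (by omega)
        rw [Finset.card_insert_of_notMem, Finset.card_insert_of_notMem,
          Finset.card_insert_of_notMem, Finset.card_insert_of_notMem, Finset.card_singleton] <;>
          simp [h1, h2, h3, h4.symm, h5, h6, h7, h8, h9, h10]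
    · refine cyc (r := fun i => f' (2 + i)) (L := 2) hgM (hf'.closed.trans h0)
        (fun i hi => mem _ (by omega)) (fun i hi => hf'.adj (2 + i) (by omega))
        (fun i j hij hj => hinj _ _ (by omega) (by omega) (by omega)) (by omega) fun _ =>
        ⟨f' 1, mem 1 (by omega), ?_, fun i hi => (hinj _ _ (by omega) (by omega) (by omega)).symm⟩
      rw [← h0]
      exact (hf'.inj 0 1 (by omega) (by omega)).symm
  · have a3 := hf'.adj 3 (by omega)
    rw [hf'.closed] at a3
    by_cases hM2 : M = 2
    · refine tri hM2 ?_
      rw [← hgM, ← h0]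
      exact a3
    · refine cyc (r := fun i => f' (3 - i)) (L := 3) hgM h0
        (fun i hi => mem _ (by omega)) (fun i hi => ?_)
        (fun i j hij hj => (hf'.inj _ _ (by omega) (by omega)).symm) (by omega) (by omega)
      have := (hf'.adj (3 - (i + 1)) (by omega)).symm
      rwa [show 3 - (i + 1) + 1 = 3 - i by omega] at this

/-- A 2-connected set satisfies the bound, or is spanned by a cycle of length five and contains no
triangle, that is, induces the 5-cycle. -/
theorem TwoConnectedOn.economical_or_five_cycle (hS : TwoConnectedOn G S) :
    Economical G S ∨ ((∃ f, IsCycleMap G f 5 ∧ cycleVerts f 5 = S) ∧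
      ∀ a ∈ S, ∀ b ∈ S, ∀ d ∈ S, G.Adj a b → G.Adj b d → ¬ G.Adj d a) := by
  have hcard := hS.card
  obtain ⟨x, hx⟩ : S.Nonempty := Finset.card_pos.1 (by omega)
  have hxS : {x} ⊆ S := by simpa using hx
  obtain ⟨a, ha, w, hw, haw⟩ := hS.conn {x} hxS (by simp) (by
    rintro rfl
    simp at hcard)
  rcases hS.exists_isEar_or hxS hw ha haw.symm with
    ⟨f, m, he, hm, hmS, -⟩ | ⟨-, u, hu, v, hv, huv, -⟩
  · have h0 := Finset.mem_singleton.1 he.start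
    have hm0 := Finset.mem_singleton.1 he.finish
    have hf : IsCycleMap G f m := by
      refine ⟨hm0.trans h0.symm, he.adj, fun i j hij hj => ?_⟩
      rcases Nat.eq_zero_or_pos i with rfl | hi
      · exact fun h => he.out j hij hj (by rw [← h, h0]; simp)
      · exact he.inj i j hi hij hj
    have hfS : cycleVerts f m ⊆ S := by
      intro z hz
      obtain ⟨i, hi, rfl⟩ := mem_cycleVerts.1 hz
      exact hmS i hi.le
    obtain rfl | rfl | hm5 : m = 3 ∨ m = 4 ∨ 5 ≤ m := by omega
    · refine .inl (hS.economical_of_triangle (hmS 0 (by omega)) (hmS 1 (by omega))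
        (hmS 2 (by omega)) (hf.adj 0 (by omega)) (hf.adj 1 (by omega)) ?_)
      have := hf.adj 2 (by omega)
      rwa [hf.closed] at this
    · exact .inl (hS.economical_of_four_cycle hf hfS)
    · by_cases h5 : m = 5 ∧ cycleVerts f m = S
      · obtain ⟨rfl, hfS'⟩ := h5
        by_cases htri : ∀ a ∈ S, ∀ b ∈ S, ∀ d ∈ S, G.Adj a b → G.Adj b d → ¬ G.Adj d a
        · exact .inr ⟨⟨f, hf, hfS'⟩, htri⟩
        · push Not at htri
          obtain ⟨a, ha, b, hb, d, hd, hab, hbd, hda⟩ := htri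
          exact .inl (hS.economical_of_triangle ha hb hd hab hbd hda)
      · exact .inl (hS.economical_of_cycle hf hfS hm5 fun h h' => h5 ⟨h, h'⟩)
  · rw [Finset.mem_singleton] at hu hv
    exact absurd (hu.trans hv.symm) huv

end

section

variable {V : Type*} {G : SimpleGraph V} {S T : Finset V} {k l : ℕ} {f : ℕ → V} {x : V}

/-! ### Cut vertices -/

/-- The subgraph induced by `S` is 2-edge-connected: two distinct edges cross every cut. -/
def TwoEdgeConnectedOn [DecidableEq V] (G : SimpleGraph V) (S : Finset V) : Prop :=
  ∀ A ⊆ S, A.Nonempty → A ≠ S → ∃ a ∈ A, ∃ b ∈ S \ A, ∃ a' ∈ A, ∃ b' ∈ S \ A,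
    G.Adj a b ∧ G.Adj a' b' ∧ (a ≠ a' ∨ b ≠ b')

theorem twoEdgeConnectedOn_univ [DecidableEq V] [Fintype V] (h : G.IsEdgeConnected 2) :
    TwoEdgeConnectedOn G Finset.univ := by
  rintro A - ⟨p, hp⟩ hA
  obtain ⟨q, hq⟩ : ∃ q, q ∉ A := by
    by_contra! hcon
    exact hA (Finset.eq_univ_iff_forall.2 hcon)
  obtain ⟨W⟩ := h.preconnected two_ne_zero p q
  obtain ⟨d, -, hd, hd'⟩ := W.exists_boundary_dart A hp hq
  obtain ⟨W'⟩ := isEdgeConnected_two.1 h s(d.fst, d.snd) p q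
  obtain ⟨e, -, he, he'⟩ := W'.exists_boundary_dart A hp hq
  have hadj := e.adj
  rw [deleteEdges_adj, Set.mem_singleton_iff] at hadj
  refine ⟨d.fst, hd, d.snd, by simpa using hd', e.fst, he, e.snd, by simpa using he', d.adj,
    hadj.1, ?_⟩
  by_contra! hcon
  exact hadj.2 (congrArg₂ (fun p q => s(p, q)) hcon.1.symm hcon.2.symm)

theorem Economical.exists_pos (h : Economical G S) (hS : 3 ≤ S.card) :
    ∃ k, 0 < k ∧ Colourable G S k ∧ 3 * k + 2 ≤ 2 * S.card := by
  obtain ⟨k, ⟨c, hc⟩, hk⟩ := h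
  exact ⟨max k 1, by omega, ⟨c, hc.mono (le_max_left _ _)⟩, by omega⟩

section

variable [DecidableEq V]

/-- A part of a 2-edge-connected set that is attached to the rest at a single vertex `x` is
2-edge-connected. -/
theorem TwoEdgeConnectedOn.part (hS : TwoEdgeConnectedOn G S) (hTS : T ⊆ S)
    (hT : ∀ a ∈ T, a ≠ x → ∀ b ∈ S, G.Adj a b → b ∈ T) : TwoEdgeConnectedOn G T := by
  intro A hA hne hAT
  by_cases hx : x ∈ A
  · -- the complement of `A` in `T` avoids `x`
    obtain ⟨a, ha, b, hb, a', ha', b', hb', h, h', hd⟩ := hS (T \ A)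
      (Finset.sdiff_subset.trans hTS)
      (Finset.sdiff_nonempty.2 fun h => hAT (hA.antisymm h))
      (fun h => (Finset.mem_sdiff.1 (h ▸ hTS (hA hx) : x ∈ T \ A)).2 hx)
    have key : ∀ p ∈ T \ A, ∀ q ∈ S \ (T \ A), G.Adj p q → q ∈ A := by
      intro p hp q hq hpq
      simp only [Finset.mem_sdiff] at hp hq
      have := hT p hp.1 (fun h => hp.2 (h ▸ hx)) q hq.1 hpq
      by_contra hqA
      exact hq.2 ⟨this, hqA⟩
    exact ⟨b, key a ha b hb h, a, ha, b', key a' ha' b' hb' h', a', ha', h.symm, h'.symm, hd.symm⟩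
  · obtain ⟨a, ha, b, hb, a', ha', b', hb', h, h', hd⟩ := hS A (hA.trans hTS) hne
      (fun h => hAT (hA.antisymm (h ▸ hTS)))
    have key : ∀ p ∈ A, ∀ q ∈ S \ A, G.Adj p q → q ∈ T \ A := by
      intro p hp q hq hpq
      rw [Finset.mem_sdiff] at hq ⊢
      exact ⟨hT p (hA hp) (fun h => hx (h ▸ hp)) q hq.1 hpq, hq.2⟩
    exact ⟨a, ha, b, key a ha b hb h, a', ha', b', key a' ha' b' hb' h', h, h', hd⟩

theorem TwoEdgeConnectedOn.three_le_card {y : V} (hS : TwoEdgeConnectedOn G S) (hx : x ∈ S)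
    (hy : y ∈ S) (hxy : x ≠ y) : 3 ≤ S.card := by
  obtain ⟨a, ha, b, hb, a', ha', b', hb', h, h', hd⟩ := hS {y} (by simpa using hy) (by simp)
    (by rintro rfl; exact hxy (by simpa using hx))
  simp only [Finset.mem_singleton] at ha ha'
  subst ha ha'
  simp only [Finset.mem_sdiff, Finset.mem_singleton] at hb hb'
  exact Finset.two_lt_card.2 ⟨_, hy, b, hb.1, b', hb'.1, Ne.symm hb.2, Ne.symm hb'.2,
    hd.resolve_left (by simp)⟩

/-- Two sets that share a single vertex can be coloured with disjoint palettes. -/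
theorem Colourable.union (hS : Colourable G S k) (hT : Colourable G T l) (hxS : x ∈ S)
    (hxT : x ∈ T) (hST : ∀ y ∈ S, y ∈ T → y = x) : Colourable G (S ∪ T) (k + l) := by
  obtain ⟨c, hc⟩ := hS
  obtain ⟨d, hd⟩ := hT
  classical
  let e : Sym2 V → ℕ := fun p => if ∀ z ∈ p, z ∈ S then c p else k + d p
  have lS : ∀ u ∈ S, ∀ v ∈ S, Linked G e (S ∪ T) (Set.Iio k) u v := by
    intro u hu v hv
    refine ((hc u hu v hv).congr fun a ha b hb => ?_).mono Finset.subset_union_left (subset_refl _)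
    simp [e, ha, hb]
  have lT : ∀ u ∈ T, ∀ v ∈ T, Linked G e (S ∪ T) (Set.Ico k (k + l)) u v := by
    intro u hu v hv
    refine ((hd u hu v hv).map (c' := e) (φ := fun n => k + n) (add_right_injective k)
      fun a ha b hb hab => ?_).mono Finset.subset_union_right ?_
    · simp only [e]
      rw [if_neg]
      intro h
      exact hab.ne ((hST a (h a (by simp)) ha).trans (hST b (h b (by simp)) hb).symm)
    · rintro _ ⟨n, hn, rfl⟩
      simp only [Set.mem_Iio, Set.mem_Ico] at hn ⊢
      omega
  have mixed : ∀ u ∈ S, ∀ v ∈ T, Linked G e (S ∪ T) (Set.Iio (k + l)) u v := by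
    intro u hu v hv
    refine (lS u hu x hxS).trans (lT x hxT v hv) ?_ ?_ ?_
    · rw [Set.disjoint_left]; intro z; simp only [Set.mem_Iio, Set.mem_Ico]; omega
    · exact Set.Iio_subset_Iio (by omega)
    · intro z; simp only [Set.mem_Iio, Set.mem_Ico]; omega
  refine ⟨e, fun u hu v hv => ?_⟩
  rcases Finset.mem_union.1 hu with hu | hu <;> rcases Finset.mem_union.1 hv with hv | hv
  · exact (lS u hu v hv).mono (subset_refl _) (Set.Iio_subset_Iio (by omega))
  · exact mixed u hu v hv
  · exact (mixed v hv u hu).symm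
  · exact (lT u hu v hv).mono (subset_refl _) (by
      intro z; simp only [Set.mem_Iio, Set.mem_Ico]; omega)

/-- A 5-cycle attached at a single vertex is an ear with both ends at this vertex. It costs two
colours only, since its middle edge takes an old colour. -/
theorem Colourable.union_five_cycle (hS : Colourable G S k) (hk : 0 < k) (hf : IsCycleMap G f 5)
    (hxS : x ∈ S) (hxf : x ∈ cycleVerts f 5) (hSf : ∀ y ∈ S, y ∈ cycleVerts f 5 → y = x) :
    Colourable G (S ∪ cycleVerts f 5) (k + 2) := by
  obtain ⟨g, hg, rfl, hgf⟩ := hf.exists_rotation hxf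
  rw [← hgf] at hSf ⊢
  have he : IsEar G S g 5 := by
    refine ⟨hxS, hg.closed ▸ hxS, hg.adj, fun i h0 hi hiS => ?_, fun i j _ hij hj => hg.inj i j hij hj⟩
    exact hg.inj 0 i h0 hi (hSf _ hiS (mem_cycleVerts.2 ⟨i, hi, rfl⟩)).symm
  have : addEar S g 5 = S ∪ cycleVerts g 5 := by
    rw [← hg.addEar_eq (by omega), addEar, addEar, ← Finset.union_assoc]
    congr 1
    exact (Finset.union_eq_left.2 (by simpa using hxS)).symm
  rw [← this]
  exact he.colourable (by omega) (by omega) (.inl hk) hS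

/-- The subgraph induced by `S` is a cycle of length five: it has a spanning one, and the absence
of triangles excludes chords. -/
def IsFiveCycleOn (G : SimpleGraph V) (S : Finset V) : Prop :=
  (∃ f, IsCycleMap G f 5 ∧ cycleVerts f 5 = S) ∧
    ∀ a ∈ S, ∀ b ∈ S, ∀ d ∈ S, G.Adj a b → G.Adj b d → ¬ G.Adj d a

theorem Economical.union_five_cycle (hS : Economical G S) (hS3 : 3 ≤ S.card)
    (hT : IsFiveCycleOn G T) (hxS : x ∈ S) (hxT : x ∈ T) (hST : ∀ y ∈ S, y ∈ T → y = x)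
    (hcard : (S ∪ T).card + 1 = S.card + T.card) : Economical G (S ∪ T) := by
  obtain ⟨k, hk, hc, hkS⟩ := hS.exists_pos hS3
  obtain ⟨⟨f, hf, rfl⟩, -⟩ := hT
  refine ⟨k + 2, hc.union_five_cycle hk hf hxS hxT hST, ?_⟩
  rw [hf.card_cycleVerts] at hcard
  omega

theorem TwoEdgeConnectedOn.economical_or_isFiveCycleOn (hS : TwoEdgeConnectedOn G S)
    (hcard : 3 ≤ S.card) : Economical G S ∨ IsFiveCycleOn G S := by
  induction hn : S.card using Nat.strong_induction_on generalizing S with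
  | _ n ih =>
    subst hn
    by_cases hcut : ∀ x ∈ S, ∀ A ⊆ S.erase x, A.Nonempty → A ≠ S.erase x →
        ∃ a ∈ A, ∃ b ∈ S.erase x \ A, G.Adj a b
    · refine TwoConnectedOn.economical_or_five_cycle ⟨hcard, fun A hA hne hAS => ?_, hcut⟩
      obtain ⟨a, ha, b, hb, -, -, -, -, hab, -⟩ := hS A hA hne hAS
      exact ⟨a, ha, b, hb, hab⟩
    push Not at hcut
    obtain ⟨x, hx, A, hA, hne, hAS, hno⟩ := hcut
    left
    -- `x` separates `A` from `B`
    obtain ⟨B, hB⟩ : ∃ B, B = S.erase x \ A := ⟨_, rfl⟩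
    have hBne : B.Nonempty := by
      rw [hB]
      exact Finset.sdiff_nonempty.2 fun h => hAS (hA.antisymm h)
    have memS : ∀ z, z ∈ S ↔ z = x ∨ z ∈ A ∨ z ∈ B := by
      intro z
      have h1 := @hA z
      simp only [hB, Finset.mem_sdiff, Finset.mem_erase] at h1 ⊢
      by_cases hzx : z = x
      · simp [hzx, hx]
      · tauto
    have hxA : x ∉ A := fun h => (Finset.mem_erase.1 (hA h)).1 rfl
    have hxB : x ∉ B := by simp [hB]
    have hAB : ∀ z ∈ A, z ∉ B := by
      intro z hz
      simp [hB, hz]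
    rw [← hB] at hno
    have hU : insert x A ∪ insert x B = S := by
      ext z
      simp only [Finset.mem_union, Finset.mem_insert, memS]
      tauto
    have hI : ∀ z ∈ insert x A, z ∈ insert x B → z = x := by
      intro z hz hz'
      rw [Finset.mem_insert] at hz hz'
      rcases hz with h | h
      · exact h
      · exact hz'.resolve_right (hAB z h)
    have pA : TwoEdgeConnectedOn G (insert x A) := by
      refine hS.part (x := x) (hU ▸ Finset.subset_union_left) fun a ha hax b hb hab => ?_
      have ha' := (Finset.mem_insert.1 ha).resolve_left hax
      rw [Finset.mem_insert]
      rcases (memS b).1 hb with h | h | h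
      · exact .inl h
      · exact .inr h
      · exact absurd hab (hno a ha' b h)
    have pB : TwoEdgeConnectedOn G (insert x B) := by
      refine hS.part (x := x) (hU ▸ Finset.subset_union_right) fun a ha hax b hb hab => ?_
      have ha' := (Finset.mem_insert.1 ha).resolve_left hax
      rw [Finset.mem_insert]
      rcases (memS b).1 hb with h | h | h
      · exact .inl h
      · exact absurd hab.symm (hno b h a ha')
      · exact .inr h
    have cA : 3 ≤ (insert x A).card := by
      obtain ⟨y, hy⟩ := hne
      exact pA.three_le_card (x := x) (y := y) (by simp) (by simp [hy]) (by rintro rfl; exact hxA hy)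
    have cB : 3 ≤ (insert x B).card := by
      obtain ⟨y, hy⟩ := hBne
      exact pB.three_le_card (x := x) (y := y) (by simp) (by simp [hy]) (by rintro rfl; exact hxB hy)
    have cS : S.card + 1 = (insert x A).card + (insert x B).card := by
      have : S = insert x (A ∪ B) := by
        ext z
        simp [memS]
      rw [this, Finset.card_insert_of_notMem hxA, Finset.card_insert_of_notMem hxB,
        Finset.card_insert_of_notMem (by simp [hxA, hxB]),
        Finset.card_union_of_disjoint (Finset.disjoint_left.2 hAB)]
      omega
    have xA : x ∈ insert x A := by simp
    have xB : x ∈ insert x B := by simp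
    have iA := ih _ (by omega) pA cA rfl
    have iB := ih _ (by omega) pB cB rfl
    rw [← hU] at cS ⊢
    rcases iA with eA | fA <;> rcases iB with eB | fB
    · obtain ⟨k, hk, hk'⟩ := eA
      obtain ⟨l, hl, hl'⟩ := eB
      exact ⟨k + l, hk.union hl xA xB hI, by omega⟩
    · exact eA.union_five_cycle cA fB xA xB hI cS
    · rw [Finset.union_comm] at cS ⊢
      exact eB.union_five_cycle cB fA xB xA (fun z h h' => hI z h' h) (by omega)
    · obtain ⟨⟨f, hf, hfA⟩, -⟩ := fA
      obtain ⟨⟨g, hg, hgB⟩, -⟩ := fB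
      rw [← hfA] at hI xA cS ⊢
      rw [← hgB] at hI xB cS ⊢
      rw [hf.card_cycleVerts, hg.card_cycleVerts] at cS
      have h3 : Colourable G (cycleVerts f 5) (1 + 5 / 2) := by
        rw [← hf.addEar_eq (by omega)]
        exact hf.isEar.colourable (by omega) (by omega) (by omega)
          ⟨fun _ => 0, rainbowOn_singleton _⟩
      exact ⟨_, h3.union_five_cycle (by omega) hg xA xB hI, by omega⟩

end

/-! ### The rainbow connection number -/

theorem rainbowConnectionNumber_le [Fintype V] (h : Colourable G Finset.univ k) (hk : 0 < k) :
    G.rainbowConnectionNumber ≤ k := by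
  classical
  obtain ⟨c, hc⟩ := h
  refine iInf₂_le k ⟨fun e => if h : c e < k then ⟨c e, h⟩ else ⟨0, hk⟩, fun u v => ?_⟩
  obtain ⟨p, -, hp, hpk⟩ := hc u (Finset.mem_univ u) v (Finset.mem_univ v)
  have sub := p.edges_bypass_subset_edges
  refine ⟨p.bypass, p.bypass_isPath, fun e he e' he' hee => Subtype.ext ?_⟩
  have h1 : c e < k := hpk _ (sub he)
  have h2 : c e' < k := hpk _ (sub he')
  simp only [h1, h2, dif_pos, Fin.mk.injEq] at hee
  exact List.inj_on_of_nodup_map hp (sub he) (sub he') hee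

/-- A rainbow path has at most as many edges as there are colours. -/
theorem length_le_of_isRainbow {t : ℕ} {c : G.edgeSet → Fin t} {u v : V} {p : G.Walk u v}
    (hp : p.IsPath) (hc : IsRainbow c p) : p.length ≤ t := by
  let l := p.edges.attach.map fun e => c ⟨e.1, p.edges_subset_edgeSet e.2⟩
  have hl : l.Nodup := by
    refine List.Nodup.map_on (fun a _ b _ hab => ?_) (List.nodup_attach.2 hp.isTrail.edges_nodup)
    have := hc (x₁ := ⟨a.1, p.edges_subset_edgeSet a.2⟩)
      (x₂ := ⟨b.1, p.edges_subset_edgeSet b.2⟩) a.2 b.2 hab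
    exact Subtype.ext (Subtype.mk.inj this)
  have := hl.length_le_card
  simpa [l] using this

theorem diam_le_rainbowConnectionNumber [Nonempty V] :
    (G.diam : ℕ∞) ≤ G.rainbowConnectionNumber := by
  refine le_iInf₂ fun t ⟨c, hc⟩ => ?_
  obtain ⟨u, v, huv⟩ := G.exists_dist_eq_diam
  obtain ⟨p, hp, hpc⟩ := hc u v
  rw [← huv]
  exact_mod_cast (dist_le p).trans (length_le_of_isRainbow hp hpc)

/-- A cycle of length five without chords, in the form of an isomorphism. -/
theorem IsFiveCycleOn.nonempty_iso [Fintype V] [DecidableEq V] (h : IsFiveCycleOn G Finset.univ) :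
    Nonempty (G ≃g cycleGraph 5) := by
  obtain ⟨⟨f, hf, hfu⟩, htri⟩ := h
  have hbij : Function.Bijective fun i : Fin 5 => f i := by
    constructor
    · intro i j hij
      exact Fin.ext (hf.injOn i.2 j.2 hij)
    · intro v
      have hv : v ∈ cycleVerts f 5 := hfu ▸ Finset.mem_univ v
      obtain ⟨i, hi, rfl⟩ := mem_cycleVerts.1 hv
      exact ⟨⟨i, hi⟩, rfl⟩
  have tri : ∀ {a b d}, G.Adj a b → G.Adj b d → ¬ G.Adj d a := fun {a b d} =>
    htri a (Finset.mem_univ _) b (Finset.mem_univ _) d (Finset.mem_univ _)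
  have h0 : G.Adj (f 0) (f 1) := hf.adj 0 (by omega)
  have h1 : G.Adj (f 1) (f 2) := hf.adj 1 (by omega)
  have h2 : G.Adj (f 2) (f 3) := hf.adj 2 (by omega)
  have h3 : G.Adj (f 3) (f 4) := hf.adj 3 (by omega)
  have h4 : G.Adj (f 4) (f 0) := hf.closed ▸ hf.adj 4 (by omega)
  have h0' := h0.symm
  have h1' := h1.symm
  have h2' := h2.symm
  have h3' := h3.symm
  have h4' := h4.symm
  have n0 := tri h0 h1
  have n1 := tri h1 h2
  have n2 := tri h2 h3
  have n3 := tri h3 h4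
  have n4 := tri h4 h0
  have n0' := fun h : G.Adj _ _ => n0 h.symm
  have n1' := fun h : G.Adj _ _ => n1 h.symm
  have n2' := fun h : G.Adj _ _ => n2 h.symm
  have n3' := fun h : G.Adj _ _ => n3 h.symm
  have n4' := fun h : G.Adj _ _ => n4 h.symm
  refine ⟨RelIso.symm ⟨Equiv.ofBijective _ hbij, fun {i j} => ?_⟩⟩
  simp only [Equiv.ofBijective_apply]
  fin_cases i <;> fin_cases j <;> first
    | exact iff_of_true (by assumption) (by decide)
    | exact iff_of_false (by assumption) (by decide)
    | exact iff_of_false G.irrefl (by decide)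

/-- The upper bound, in terms of sets. -/
theorem rainbowConnectionNumber_le_or_isFiveCycleOn [Fintype V] [DecidableEq V] (hV : 3 ≤ Fintype.card V)
    (hG : G.IsEdgeConnected 2) :
    (∃ k : ℕ, G.rainbowConnectionNumber ≤ k ∧ 3 * k + 2 ≤ 2 * Fintype.card V) ∨
      IsFiveCycleOn G Finset.univ := by
  rw [← Finset.card_univ] at hV ⊢
  refine ((twoEdgeConnectedOn_univ hG).economical_or_isFiveCycleOn hV).imp_left fun h => ?_
  obtain ⟨k, hk, hc, hkV⟩ := h.exists_pos hV
  exact ⟨k, rainbowConnectionNumber_le hc hk, hkV⟩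

end

section

variable {V : Type*} {G : SimpleGraph V}

/-! ### The 5-cycle -/

theorem rainbowConnectionNumber_five_cycle_le : (cycleGraph 5).rainbowConnectionNumber ≤ 3 := by
  have hf : IsCycleMap (cycleGraph 5) (fun i => Fin.ofNat 5 i) 5 := by
    refine ⟨rfl, fun i hi => ?_, fun i j hij hj => ?_⟩
    · interval_cases i <;> decide
    · interval_cases j <;> interval_cases i <;> decide
  have hu : cycleVerts (fun i => Fin.ofNat 5 i) 5 = Finset.univ := by decide
  have h := hf.isEar.colourable (by omega) (by omega) (by omega)
    ⟨fun _ => 0, rainbowOn_singleton (k := 1) _⟩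
  rw [hf.addEar_eq (by omega), hu] at h
  exact_mod_cast rainbowConnectionNumber_le h (by norm_num)

/-- With two colours, the ends of any two consecutive edges force these edges to have different
colours, which is impossible around a cycle of odd length. -/
theorem three_le_rainbowConnectionNumber_five_cycle :
    3 ≤ (cycleGraph 5).rainbowConnectionNumber := by
  refine le_iInf₂ fun t ⟨c, hc⟩ => ?_
  by_contra! hlt
  have ht : t ≤ 2 := by
    have : t < 3 := by exact_mod_cast hlt
    omega
  have hadj : ∀ i : Fin 5, (cycleGraph 5).Adj i (i + 1) := by decide
  have d0 : ∀ i : Fin 5, i + 1 + 1 ≠ i := by decide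
  have d1 : ∀ i : Fin 5, ¬ (cycleGraph 5).Adj i (i + 1 + 1) := by decide
  have d2 : ∀ i z : Fin 5, (cycleGraph 5).Adj i z → (cycleGraph 5).Adj z (i + 1 + 1) →
      z = i + 1 := by decide
  have d3 : ∀ i : Fin 5, s(i, i + 1) ≠ s(i + 1, i + 1 + 1) := by decide
  let e : Fin 5 → (cycleGraph 5).edgeSet := fun i => ⟨s(i, i + 1), hadj i⟩
  have key : ∀ i, c (e i) ≠ c (e (i + 1)) := by
    intro i h
    obtain ⟨j, hj⟩ : ∃ j, j = i + 1 + 1 := ⟨_, rfl⟩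
    obtain ⟨p, hp, hpc⟩ := hc i j
    have hl := length_le_of_isRainbow hp hpc
    rcases p with _ | ⟨h1, _ | ⟨h2, _ | ⟨h3, q⟩⟩⟩
    · exact d0 i hj.symm
    · exact d1 i (hj ▸ h1)
    · subst hj
      obtain rfl := d2 _ _ h1 h2
      have := hpc (x₁ := e i) (x₂ := e (i + 1)) (by simp [e]) (by simp [e]) h
      exact d3 i (congrArg Subtype.val this)
    · simp only [Walk.length_cons] at hl
      omega
  have k0 : c (e 0) ≠ c (e 1) := key 0
  have k1 : c (e 1) ≠ c (e 2) := key 1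
  have k2 : c (e 2) ≠ c (e 3) := key 2
  have k3 : c (e 3) ≠ c (e 4) := key 3
  have k4 : c (e 4) ≠ c (e 0) := key 4
  rw [ne_eq, Fin.ext_iff] at k0 k1 k2 k3 k4
  omega

/-! ### Graphs attaining the bound -/

theorem isEdgeConnected_two_of_triangles (hG : G.Preconnected)
    (htri : ∀ u v, G.Adj u v → ∃ z, G.Adj u z ∧ G.Adj z v) : G.IsEdgeConnected 2 := by
  rw [isEdgeConnected_two]
  intro e u v
  obtain ⟨p⟩ := hG u v
  induction p with
  | nil => exact .rfl
  | cons h p ih =>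
    refine .trans ?_ ih
    rename_i a b _
    by_cases he : s(a, b) = e
    · obtain ⟨z, haz, hzb⟩ := htri a b h
      have h1 : (G.deleteEdges {e}).Adj a z := by
        rw [deleteEdges_adj, ← he]
        exact ⟨haz, fun hs => hzb.ne (Sym2.congr_right.1 hs)⟩
      have h2 : (G.deleteEdges {e}).Adj z b := by
        rw [deleteEdges_adj, ← he]
        exact ⟨hzb, fun hs => haz.ne (Sym2.congr_left.1 hs).symm⟩
      exact h1.reachable.trans h2.reachable
    · exact Adj.reachable (by rw [deleteEdges_adj]; exact ⟨h, he⟩)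

/-- The graph in which distinct vertices are adjacent when their levels differ by at most one. -/
def levelGraph {α : Type*} (lvl : α → ℕ) : SimpleGraph α where
  Adj u v := u ≠ v ∧ lvl u ≤ lvl v + 1 ∧ lvl v ≤ lvl u + 1
  symm := ⟨fun _ _ h => ⟨h.1.symm, h.2.2, h.2.1⟩⟩
  loopless := ⟨fun _ h => h.1 rfl⟩

section

variable {α : Type*} {lvl : α → ℕ} {M : ℕ}

theorem level_le_add_length {u v : α} (p : (levelGraph lvl).Walk u v) :
    lvl v ≤ lvl u + p.length := by
  induction p with
  | nil => simp
  | cons h p ih =>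
    have := h.2.2
    rw [Walk.length_cons]
    omega

theorem levelGraph_preconnected (hlvl : ∀ v, lvl v ≤ M) (hM : ∀ j ≤ M, ∃ v, lvl v = j) :
    (levelGraph lvl).Preconnected := by
  obtain ⟨w, hw⟩ := hM 0 (Nat.zero_le _)
  have key : ∀ j v, lvl v = j → (levelGraph lvl).Reachable v w := by
    intro j
    induction j with
    | zero =>
      intro v hv
      by_cases h : v = w
      · exact h ▸ .rfl
      · exact Adj.reachable ⟨h, by omega, by omega⟩
    | succ j ih =>
      intro v hv
      obtain ⟨u, hu⟩ := hM j (by have := hlvl v; omega)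
      refine .trans (Adj.reachable ?_) (ih u hu)
      exact ⟨by rintro rfl; omega, by omega, by omega⟩
  exact fun u v => (key _ u rfl).trans (key _ v rfl).symm

/-- Every edge lies in a triangle, because the odd levels contain more than one vertex. -/
theorem levelGraph_triangle (hM1 : 1 ≤ M) (hlvl : ∀ v, lvl v ≤ M) (hM : ∀ j ≤ M, ∃ v, lvl v = j)
    (hodd : ∀ v, lvl v % 2 = 1 → ∃ v', v' ≠ v ∧ lvl v' = lvl v) {u v : α}
    (h : (levelGraph lvl).Adj u v) :
    ∃ z, (levelGraph lvl).Adj u z ∧ (levelGraph lvl).Adj z v := by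
  obtain ⟨hne, h1, h2⟩ := h
  have third : ∀ z, z ≠ u → z ≠ v → lvl u ≤ lvl z + 1 → lvl z ≤ lvl u + 1 → lvl v ≤ lvl z + 1 →
      lvl z ≤ lvl v + 1 → ∃ z, (levelGraph lvl).Adj u z ∧ (levelGraph lvl).Adj z v :=
    fun z zu zv a b a' b' => ⟨z, ⟨zu.symm, a, b⟩, ⟨zv, b', a'⟩⟩
  by_cases heq : lvl u = lvl v
  · -- a vertex on a neighbouring level
    obtain ⟨z, hz⟩ := hM (if lvl u = 0 then 1 else lvl u - 1) (by
      have := hlvl u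
      split <;> omega)
    split at hz <;>
      exact third z (by rintro rfl; omega) (by rintro rfl; omega) (by omega) (by omega) (by omega)
        (by omega)
  · by_cases hu : lvl u % 2 = 1
    · obtain ⟨z, hzu, hz⟩ := hodd u hu
      exact third z hzu (by rintro rfl; omega) (by omega) (by omega) (by omega) (by omega)
    · obtain ⟨z, hzv, hz⟩ := hodd v (by omega)
      exact third z (by rintro rfl; omega) hzv (by omega) (by omega) (by omega) (by omega)

/-- A graph on `n` vertices with levels `0, …, ⌊(2n - 2) / 3⌋`, the odd ones of size at least two,
attains the bound. -/
theorem levelGraph_spec [Fintype α] (hα : 3 ≤ Fintype.card α)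
    (hcard : M = (2 * Fintype.card α - 2) / 3)
    (hlvl : ∀ v, lvl v ≤ M) (hM : ∀ j ≤ M, ∃ v, lvl v = j)
    (hodd : ∀ v, lvl v % 2 = 1 → ∃ v', v' ≠ v ∧ lvl v' = lvl v) :
    (levelGraph lvl).IsEdgeConnected 2 ∧ (levelGraph lvl).diam = M ∧
      (levelGraph lvl).rainbowConnectionNumber = M := by
  classical
  have hM1 : 1 ≤ M := by omega
  have hpre := levelGraph_preconnected hlvl hM
  obtain ⟨u, hu⟩ := hM 0 (Nat.zero_le _)
  obtain ⟨v, hv⟩ := hM M le_rfl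
  obtain ⟨w, hw⟩ := hM 1 hM1
  have : Nonempty α := ⟨u⟩
  have tri := fun {u v} => levelGraph_triangle (u := u) (v := v) hM1 hlvl hM hodd
  have h2 := isEdgeConnected_two_of_triangles hpre fun _ _ => tri
  have hle : (levelGraph lvl).rainbowConnectionNumber ≤ M := by
    rcases rainbowConnectionNumber_le_or_isFiveCycleOn hα h2 with ⟨k, hk, hk'⟩ | h5
    · exact hk.trans (by exact_mod_cast (by omega : k ≤ M))
    · have huw : (levelGraph lvl).Adj u w := ⟨by rintro rfl; omega, by omega, by omega⟩
      obtain ⟨z, hz, hz'⟩ := tri huw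
      exact absurd huw.symm (h5.2 u (Finset.mem_univ _) z (Finset.mem_univ _) w (Finset.mem_univ _)
        hz hz')
  have hdiam : M ≤ (levelGraph lvl).diam := by
    have hc : (levelGraph lvl).Connected := ⟨hpre⟩
    obtain ⟨p, hp⟩ := (hpre u v).exists_walk_length_eq_dist
    have := level_le_add_length p
    have := dist_le_diam (connected_iff_ediam_ne_top.1 hc) (u := u) (v := v)
    omega
  have hdr := diam_le_rainbowConnectionNumber (G := levelGraph lvl)
  refine ⟨h2, le_antisymm ?_ hdiam, le_antisymm hle ?_⟩
  · exact_mod_cast hdr.trans hle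
  · exact le_trans (by exact_mod_cast hdiam) hdr

end

/-- The level of vertex `i` when the levels have sizes `1, 2, 1, 2, …`, except that the vertex `s`
is moved to the level `l`. -/
def level (s l i : ℕ) : ℕ := if i = s then l else 2 * (i / 3) + (i % 3 + 1) / 2

theorem exists_extremal_one {k : ℕ} (hk : 1 ≤ k) : ∃ G : SimpleGraph (Fin (3 * k + 1)),
    G.IsEdgeConnected 2 ∧ G.diam = 2 * k ∧ G.rainbowConnectionNumber = ((2 * k : ℕ) : ℕ∞) := by
  -- no vertex is moved
  refine ⟨levelGraph fun i => level (3 * k + 1) 0 i, levelGraph_spec (by simp; omega)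
    (by simp; omega) (fun i => ?_) (fun j hj => ?_) (fun i hi => ?_)⟩
  · have := i.2
    simp only [level]
    split <;> omega
  · refine ⟨⟨3 * (j / 2) + j % 2, by omega⟩, ?_⟩
    simp only [level]
    split <;> omega
  · have := i.2
    simp only [level] at hi
    rw [if_neg (by omega)] at hi
    by_cases h1 : i.1 % 3 = 1
    · refine ⟨⟨i + 1, by omega⟩, by simp [Fin.ext_iff], ?_⟩
      simp only [level]
      split_ifs <;> omega
    · refine ⟨⟨i - 1, by omega⟩, by simp only [ne_eq, Fin.ext_iff]; omega, ?_⟩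
      simp only [level]
      split_ifs <;> omega

theorem exists_extremal_two {k : ℕ} (hk : 1 ≤ k) : ∃ G : SimpleGraph (Fin (3 * k + 2)),
    G.IsEdgeConnected 2 ∧ G.diam = 2 * k ∧ G.rainbowConnectionNumber = ((2 * k : ℕ) : ℕ∞) := by
  -- the last vertex becomes a third vertex of level `2 * k - 1`
  refine ⟨levelGraph fun i => level (3 * k + 1) (2 * k - 1) i, levelGraph_spec (by simp; omega)
    (by simp; omega) (fun i => ?_) (fun j hj => ?_) (fun i hi => ?_)⟩
  · have := i.2
    simp only [level]
    split <;> omega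
  · refine ⟨⟨3 * (j / 2) + j % 2, by omega⟩, ?_⟩
    simp only [level]
    split <;> omega
  · have := i.2
    simp only [level] at hi
    by_cases hs : i.1 = 3 * k + 1
    · refine ⟨⟨i - 2, by omega⟩, by simp only [ne_eq, Fin.ext_iff]; omega, ?_⟩
      simp only [level]
      split_ifs <;> omega
    rw [if_neg hs] at hi
    by_cases h1 : i.1 % 3 = 1
    · refine ⟨⟨i + 1, by omega⟩, by simp [Fin.ext_iff], ?_⟩
      simp only [level]
      split_ifs <;> omega
    · refine ⟨⟨i - 1, by omega⟩, by simp only [ne_eq, Fin.ext_iff]; omega, ?_⟩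
      simp only [level]
      split_ifs <;> omega

theorem exists_extremal_three (k : ℕ) : ∃ G : SimpleGraph (Fin (3 * k + 3)),
    G.IsEdgeConnected 2 ∧ G.diam = 2 * k + 1 ∧
      G.rainbowConnectionNumber = ((2 * k + 1 : ℕ) : ℕ∞) := by
  -- no vertex is moved
  refine ⟨levelGraph fun i => level (3 * k + 3) 0 i, levelGraph_spec (by simp)
    (by simp; omega) (fun i => ?_) (fun j hj => ?_) (fun i hi => ?_)⟩
  · have := i.2
    simp only [level]
    split <;> omega
  · refine ⟨⟨3 * (j / 2) + j % 2, by omega⟩, ?_⟩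
    simp only [level]
    split <;> omega
  · have := i.2
    simp only [level] at hi
    rw [if_neg (by omega)] at hi
    by_cases h1 : i.1 % 3 = 1
    · refine ⟨⟨i + 1, by omega⟩, by simp [Fin.ext_iff], ?_⟩
      simp only [level]
      split_ifs <;> omega
    · refine ⟨⟨i - 1, by omega⟩, by simp only [ne_eq, Fin.ext_iff]; omega, ?_⟩
      simp only [level]
      split_ifs <;> omega

end

end RainbowConnection

theorem theorem2 :
    -- the upper bound, for every 2-edge-connected graph of order at least 3 other than the 5-cycle
    (∀ (V : Type*) [Fintype V] (G : SimpleGraph V), 3 ≤ Fintype.card V → G.IsEdgeConnected 2 →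
      IsEmpty (G ≃g SimpleGraph.cycleGraph 5) →
        (∀ k : ℕ,
          (Fintype.card V = 3 * k + 1 ∨ Fintype.card V = 3 * k + 2 →
            G.rainbowConnectionNumber ≤ ((2 * k : ℕ) : ℕ∞)) ∧
          (Fintype.card V = 3 * k + 3 →
            G.rainbowConnectionNumber ≤ ((2 * k + 1 : ℕ) : ℕ∞))) ∧
        G.rainbowConnectionNumber ≤ ((⌊(2 * (Fintype.card V : ℚ) - 2) / 3⌋₊ : ℕ) : ℕ∞)) ∧
    -- the value for the 5-cycle
    (SimpleGraph.cycleGraph 5).rainbowConnectionNumber = 3 ∧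
    -- the bound is smaller than `4n/5 - 1`
    (∀ n : ℕ, 3 ≤ n → ((⌊(2 * (n : ℚ) - 2) / 3⌋₊ : ℕ) : ℚ) < 4 * (n : ℚ) / 5 - 1) ∧
    -- tightness for every order, by graphs whose diameter equals the bound
    (∀ k : ℕ, 1 ≤ k → ∃ G : SimpleGraph (Fin (3 * k + 1)), G.IsEdgeConnected 2 ∧
      G.diam = 2 * k ∧ G.rainbowConnectionNumber = ((2 * k : ℕ) : ℕ∞)) ∧
    (∀ k : ℕ, 1 ≤ k → ∃ G : SimpleGraph (Fin (3 * k + 2)), G.IsEdgeConnected 2 ∧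
      G.diam = 2 * k ∧ G.rainbowConnectionNumber = ((2 * k : ℕ) : ℕ∞)) ∧
    (∀ k : ℕ, ∃ G : SimpleGraph (Fin (3 * k + 3)), G.IsEdgeConnected 2 ∧
      G.diam = 2 * k + 1 ∧ G.rainbowConnectionNumber = ((2 * k + 1 : ℕ) : ℕ∞)) := by

  refine ⟨fun V _ G hV hG hC => ?_, ?_, fun n hn => ?_, fun k hk => ?_, fun k hk => ?_, fun k => ?_⟩
  · classical
    obtain ⟨k, hk, hkV⟩ : ∃ k : ℕ, G.rainbowConnectionNumber ≤ k ∧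
        3 * k + 2 ≤ 2 * Fintype.card V :=
      (RainbowConnection.rainbowConnectionNumber_le_or_isFiveCycleOn hV hG).resolve_right fun h =>
        h.nonempty_iso.elim hC.false
    have bound : ∀ m : ℕ, k ≤ m → G.rainbowConnectionNumber ≤ m :=
      fun m hm => hk.trans (by exact_mod_cast hm)
    refine ⟨fun j => ⟨fun h => bound _ (by omega), fun h => bound _ (by omega)⟩, bound _ ?_⟩
    apply Nat.le_floor
    have : (3 * k + 2 : ℚ) ≤ 2 * Fintype.card V := by exact_mod_cast hkV
    linarith
  · exact le_antisymm RainbowConnection.rainbowConnectionNumber_five_cycle_le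
      RainbowConnection.three_le_rainbowConnectionNumber_five_cycle
  · have hn' : (3 : ℚ) ≤ n := by exact_mod_cast hn
    have := Nat.floor_le (show (0 : ℚ) ≤ (2 * (n : ℚ) - 2) / 3 by linarith)
    linarith
  · exact RainbowConnection.exists_extremal_one hk
  · exact RainbowConnection.exists_extremal_two hk
  · exact RainbowConnection.exists_extremal_three k
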